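/- **Theorem (rate of convergence of the imputed outcomes and propensity scores).** *Setting.* For each $N\ge 1$ there is a panel with individuals $i=1,\dots,N$ and periods $s=1,\dots,T$, defined on a (standard Borel) probability space; $T_0$ and $T$ depend on $N$, $1\le T_0<T$, and $t=t_N$ is a post-treatment period, $T_0<t\le T$. Individual factors $\alpha_i\in\mathbb R^{d_\alpha}$ and period factors $\lambda_s\in\mathcal L$ are latent. Untreated potential outcomes and binary treatment indicators $w_{i,s}\in\{0,1\}$ satisfy $$Y_{i,s}(0)=\mu^{(0)}(\alpha_i,\lambda_s)+u_{i,s},\qquad w_{i,s}=p_s(\alpha_i)+\epsilon_{i,s},$$ and $w_{i,s}=0$ for all $s\le T_0$. The functions $p_s$ may depend on $N$; $\mu^{(0)}$, the law of $\alpha_i$, the law $\pi$ of $\lambda_s$ and the kernel $K$ do not. Put $\mu^{(0)}_{i,s}=\mu^{(0)}(\alpha_i,\lambda_s)$ and $p_{i,s}=p_s(\alpha_i)$. The observed data are $(Y_{i,s},w_{i,s})$. With a bandwidth $h=h_N>0$ that is bounded in $N$ (for example $h_N\to0$) let $$\hat d_{i,j}=\frac1{T_0}\max_{k\notin\{i,j\}}\Big|\sum_{s=1}^{T_0}Y_{k,s}(Y_{i,s}-Y_{j,s})\Big|,\qquad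 \hat\mu^{(0)}_{i,t}=\frac{\sum_{j:\,w_{j,t}=0}K(\hat d_{i,j}/h)\,Y_{j,t}}{\sum_{j:\,w_{j,t}=0}K(\hat d_{i,j}/h)},\qquad \hat p_{i,t}=\frac{\sum_{j}K(\hat d_{i,j}/h)\,w_{j,t}}{\sum_{j}K(\hat d_{i,j}/h)}.$$ *Assumptions* (all constants are independent of $N$). 1. (No anticipation) $w_{i,s}=0$ implies $Y_{i,s}=Y_{i,s}(0)$. 2. (Latent unconfoundedness) $Y_{i,s}(0)$ and $w_{i,s}$ are conditionally independent given the latent factors $(\alpha_k)_{k\le N},(\lambda_r)_{r\le T}$. 3. (Latent independence) For $i\ne j$, $Y_{i,s}(0)$ and $Y_{j,s}(0)$ are conditionally independent given $(\alpha_k)_{k\le N},\lambda_s$. 4. (Model and latent factors) (i) There is $c>0$ with $1-p_{i,s}\ge c$ almost surely for all $i$ and $s>T_0$. (ii) Given all latent factors, $u_{i,s}$ and $\epsilon_{i,s}$ have mean zero and, for some $\delta\ge0$, satisfy $\mathbb E[\exp(\eta u_{i,s})\mid\alpha,\lambda]\le\exp(\delta\eta^2)$ for all $\eta\in\mathbb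 R$ almost surely, and likewise for $\epsilon_{i,s}$; the pairs $(u_{i,s},\epsilon_{i,s})$, $i\le N$, $s\in\{1,\dots,T_0\}\cup\{t\}$, are conditionally independent given all latent factors. (iii) The $\alpha_i$ are i.i.d., the $\lambda_s$ are i.i.d. with law $\pi$, and the two families are independent of each other. The support of $\alpha_i$ lies in a compact set $\mathcal A\subset\mathbb R^{d_\alpha}$, and there are $0<\underline c<\bar c<\infty$ and $\eta_0>0$ with $\underline c\,\eta^{d_\alpha}\le\mathbb P(\|\alpha-\alpha_i\|\le\eta)\le\bar c\,\eta^{d_\alpha}$ for all $\alpha\in\operatorname{supp}(\alpha_i)$ and $0<\eta\le\eta_0$. (iv) $\mu^{(0)}$ on $\mathcal A\times\mathcal L$ and the $p_s$ on $\mathcal A$ are uniformly bounded, and for some $L_0,L_p<\infty$, $|\mu^{(0)}(a,\lambda)-\mu^{(0)}(b,\lambda)|\le L_0\|a-b\|$ and $|p_s(a)-p_s(b)|\le L_p\|a-b\|$ for all $a,b\in\mathcal A$, $\lambda\in\mathcal L$ and $1\le s\le T$. (v) $K$ on $[0,\infty)$ is nonnegative, bounded, Lipschitz, of compact support, and $K(0)>0$.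 (vi) There are $c_1,c_2>0$ such that for all $a,b\in\mathcal A$, with $D(a,b)=\int(\mu^{(0)}(a,\lambda)-\mu^{(0)}(b,\lambda))^2\,d\pi(\lambda)$, $$D(a,b)\ge c_1\|a-b\|^2,\qquad \sup_{e\in\operatorname{supp}(\alpha_i)}\int\mu^{(0)}(e,\lambda)\big(\mu^{(0)}(a,\lambda)-\mu^{(0)}(b,\lambda)\big)\,d\pi(\lambda)\ge c_2\sqrt{D(a,b)}.$$ *Conclusion.* If, as $N\to\infty$, $\frac1h\sqrt{\log N/T_0}\to0$ and $\frac{\log N}{h^{2d_\alpha}N}\to0$, then $$\max_{i\le N}\big|\hat\mu^{(0)}_{i,t}-\mu^{(0)}_{i,t}\big|=O_p\Big(h+\sqrt{\tfrac{\log N}{h^{d_\alpha}N}}\Big),\qquad \max_{i\le N}\big|\hat p_{i,t}-p_{i,t}\big|=O_p\Big(h+\sqrt{\tfrac{\log N}{h^{d_\alpha}N}}\Big).$$ -/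

import Mathlib

open MeasureTheory ProbabilityTheory Filter Topology
open scoped NNReal

namespace LatentPanel

/-- The Euclidean space in which the individual latent factors live. -/
abbrev Vec (d : ℕ) : Type := EuclideanSpace ℝ (Fin d)

/-- The random variables of a panel with individuals `i : Fin N` and periods `s = 1, 2, …`:
the individual factors `α i`, the period factors `lam s`, the untreated potential outcomes
`Y0 i s`, the observed outcomes `Y i s` and the treatment indicators `w i s`.
No relation between them is imposed here. -/
structure Panel (Ω : Type*) [MeasurableSpace Ω] (d : ℕ) (L : Type*) [MeasurableSpace L]
    (N : ℕ) where
  α : Fin N → Ω → Vec d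
  lam : ℕ → Ω → L
  Y0 : Fin N → ℕ → Ω → ℝ
  Y : Fin N → ℕ → Ω → ℝ
  w : Fin N → ℕ → Ω → ℝ
  measurable_α : ∀ i, Measurable (α i)
  measurable_lam : ∀ s, Measurable (lam s)
  measurable_Y0 : ∀ i s, Measurable (Y0 i s)
  measurable_Y : ∀ i s, Measurable (Y i s)
  measurable_w : ∀ i s, Measurable (w i s)

section Estimators

variable {N : ℕ}

/-- The pseudo-distance
`(1 / T₀) * max_{k ∉ {i, j}} |⟨Y_{k,1:T₀}, Y_{i,1:T₀} - Y_{j,1:T₀}⟩|`. -/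
noncomputable def pseudoDist (T0 : ℕ) (y : Fin N → ℕ → ℝ) (i j : Fin N) : ℝ :=
  (1 / (T0 : ℝ)) * ⨆ k : {k : Fin N // k ≠ i ∧ k ≠ j},
    |∑ s ∈ Finset.Icc 1 T0, y k s * (y i s - y j s)|

/-- The kernel estimate of the untreated conditional mean of individual `i` in period `t`,
with bandwidth `h`. -/
noncomputable def muHat (K : ℝ → ℝ) (h : ℝ) (T0 t : ℕ) (y w : Fin N → ℕ → ℝ)
    (i : Fin N) : ℝ :=
  (∑ j ∈ Finset.univ.filter (fun j => w j t = 0), K (pseudoDist T0 y i j / h) * y j t) /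
    (∑ j ∈ Finset.univ.filter (fun j => w j t = 0), K (pseudoDist T0 y i j / h))

/-- The kernel estimate of the propensity score of individual `i` in period `t`. -/
noncomputable def pHat (K : ℝ → ℝ) (h : ℝ) (T0 t : ℕ) (y w : Fin N → ℕ → ℝ)
    (i : Fin N) : ℝ :=
  (∑ j, K (pseudoDist T0 y i j / h) * w j t) / (∑ j, K (pseudoDist T0 y i j / h))

end Estimators

namespace Panel

variable {Ω : Type*} [mΩ : MeasurableSpace Ω] {d : ℕ} {L : Type*} [MeasurableSpace L] {N : ℕ}

/-- The residual `u_{i,s} = Y_{i,s}(0) - μ⁽⁰⁾(α_i, λ_s)` of the outcome model. -/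
def u (X : Panel Ω d L N) (mu0 : Vec d → L → ℝ) (i : Fin N) (s : ℕ) (ω : Ω) : ℝ :=
  X.Y0 i s ω - mu0 (X.α i ω) (X.lam s ω)

/-- The residual `ε_{i,s} = w_{i,s} - p_s(α_i)` of the treatment model. -/
def eps (X : Panel Ω d L N) (p : ℕ → Vec d → ℝ) (i : Fin N) (s : ℕ) (ω : Ω) : ℝ :=
  X.w i s ω - p s (X.α i ω)

/-- The σ-algebra generated by all latent factors `α_1, …, α_N, λ_1, …, λ_T`. -/
def latent (X : Panel Ω d L N) (T : ℕ) : MeasurableSpace Ω :=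
  (⨆ i, MeasurableSpace.comap (X.α i) inferInstance) ⊔
    ⨆ s : Finset.Icc 1 T, MeasurableSpace.comap (X.lam s) inferInstance

theorem latent_le (X : Panel Ω d L N) (T : ℕ) : X.latent T ≤ mΩ :=
  sup_le (iSup_le fun i => (X.measurable_α i).comap_le)
    (iSup_le fun s => (X.measurable_lam s).comap_le)

/-- The σ-algebra generated by `α_1, …, α_N` and the single period factor `λ_s`. -/
def latentAt (X : Panel Ω d L N) (s : ℕ) : MeasurableSpace Ω :=
  (⨆ i, MeasurableSpace.comap (X.α i) inferInstance) ⊔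
    MeasurableSpace.comap (X.lam s) inferInstance

theorem latentAt_le (X : Panel Ω d L N) (s : ℕ) : X.latentAt s ≤ mΩ :=
  sup_le (iSup_le fun i => (X.measurable_α i).comap_le) (X.measurable_lam s).comap_le

/-- `w` is a binary treatment indicator and nobody is treated in the periods `1, …, T₀`. -/
def BinaryTreatment (X : Panel Ω d L N) (P : Measure Ω) (T0 T : ℕ) : Prop :=
  (∀ i, ∀ s ∈ Finset.Icc 1 T, ∀ᵐ ω ∂P, X.w i s ω = 0 ∨ X.w i s ω = 1) ∧
    ∀ i, ∀ s ∈ Finset.Icc 1 T0, ∀ᵐ ω ∂P, X.w i s ω = 0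

/-- No anticipation: if `w_{i,s} = 0` then `Y_{i,s} = Y_{i,s}(0)`. -/
def NoAnticipation (X : Panel Ω d L N) (P : Measure Ω) (T : ℕ) : Prop :=
  ∀ i, ∀ s ∈ Finset.Icc 1 T, ∀ᵐ ω ∂P, X.w i s ω = 0 → X.Y i s ω = X.Y0 i s ω

/-- Latent unconfoundedness: `Y_{i,s}(0)` and `w_{i,s}` are conditionally independent given the
latent factors. -/
def LatentUnconfounded [StandardBorelSpace Ω] (X : Panel Ω d L N) (P : Measure Ω)
    [IsFiniteMeasure P] (T : ℕ) : Prop :=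
  ∀ i, ∀ s ∈ Finset.Icc 1 T, CondIndepFun (X.latent T) (X.latent_le T) (X.Y0 i s) (X.w i s) P

/-- Latent independence: for `i ≠ j`, `Y_{i,s}(0)` and `Y_{j,s}(0)` are conditionally independent
given `α_1, …, α_N` and `λ_s`. -/
def LatentIndependent [StandardBorelSpace Ω] (X : Panel Ω d L N) (P : Measure Ω)
    [IsFiniteMeasure P] (T : ℕ) : Prop :=
  ∀ i j, i ≠ j → ∀ s ∈ Finset.Icc 1 T,
    CondIndepFun (X.latentAt s) (X.latentAt_le s) (X.Y0 i s) (X.Y0 j s) P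

/-- Overlap with constant `c` in all post-treatment periods: the conditional probability
`1 - p_s(α_i)` of being untreated is at least `c`. -/
def Overlap (X : Panel Ω d L N) (P : Measure Ω) (T0 T : ℕ) (p : ℕ → Vec d → ℝ) (c : ℝ) : Prop :=
  ∀ i, ∀ s ∈ Finset.Ioc T0 T, ∀ᵐ ω ∂P, c ≤ 1 - p s (X.α i ω)

/-- The residuals have conditional mean zero given the latent factors and are conditionally
sub-Gaussian, `E[exp(η u) | α, λ] ≤ exp(δ η²)` for all real `η` almost surely (Mathlib's variance
proxy is `2 δ`); the pairs `(u_{i,s}, ε_{i,s})`, over all individuals and over the pre-treatment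
periods `1, …, T₀` together with the period `t`, are independent given the latent factors.
The remaining post-treatment periods are left out of the last clause because the indicators of
an absorbing treatment are dependent across those. -/
structure ErrorConditions [StandardBorelSpace Ω] (X : Panel Ω d L N) (P : Measure Ω)
    [IsFiniteMeasure P] (T0 T t : ℕ) (mu0 : Vec d → L → ℝ) (p : ℕ → Vec d → ℝ)
    (δ : ℝ≥0) : Prop where
  mean_u : ∀ i, ∀ s ∈ Finset.Icc 1 T, P[X.u mu0 i s | X.latent T] =ᵐ[P] 0
  mean_eps : ∀ i, ∀ s ∈ Finset.Icc 1 T, P[X.eps p i s | X.latent T] =ᵐ[P] 0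
  subgaussian_u : ∀ i, ∀ s ∈ Finset.Icc 1 T,
    HasCondSubgaussianMGF (X.latent T) (X.latent_le T) (X.u mu0 i s) (2 * δ) P
  subgaussian_eps : ∀ i, ∀ s ∈ Finset.Icc 1 T,
    HasCondSubgaussianMGF (X.latent T) (X.latent_le T) (X.eps p i s) (2 * δ) P
  indep : iCondIndepFun (X.latent T) (X.latent_le T)
    (fun (q : Fin N × ↥(insert t (Finset.Icc 1 T0))) (ω : Ω) =>
      (X.u mu0 q.1 q.2 ω, X.eps p q.1 q.2 ω)) P

/-- The `α_i` are i.i.d. with law `ν`, the `λ_s` are i.i.d. with law `π`, and the two families are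
independent of each other. -/
structure FactorSampling (X : Panel Ω d L N) (P : Measure Ω) (T : ℕ) (ν : Measure (Vec d))
    (π : Measure L) : Prop where
  law_α : ∀ i, P.map (X.α i) = ν
  law_lam : ∀ s ∈ Finset.Icc 1 T, P.map (X.lam s) = π
  indep_α : iIndepFun X.α P
  indep_lam : iIndepFun (fun (s : Finset.Icc 1 T) => X.lam s) P
  indep : IndepFun (fun ω i => X.α i ω) (fun ω (s : Finset.Icc 1 T) => X.lam s ω) P

end Panel

/-- The law `ν` of the individual factors has support in the compact set `A`, and small balls
around points of the support have mass of the exact order `η ^ d`. -/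
def FactorLaw {d : ℕ} (A : Set (Vec d)) (ν : Measure (Vec d)) : Prop :=
  IsCompact A ∧ ν.support ⊆ A ∧
    ∃ c C η₀ : ℝ, 0 < c ∧ c < C ∧ 0 < η₀ ∧ ∀ a ∈ ν.support, ∀ η : ℝ, 0 < η → η ≤ η₀ →
      c * η ^ d ≤ ν.real (Metric.closedBall a η) ∧ ν.real (Metric.closedBall a η) ≤ C * η ^ d

/-- Uniform boundedness and uniform Lipschitz continuity in the individual factor of `μ⁽⁰⁾` and of
the propensity scores `p_s`, `1 ≤ s ≤ T`, of all panels. The latter depend on the panel, since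
`p_s` vanishes in the pre-treatment periods, whose number grows. -/
def Smoothness {d : ℕ} {L : Type*} (A : Set (Vec d)) (mu0 : Vec d → L → ℝ)
    (p : ℕ → ℕ → Vec d → ℝ) (T : ℕ → ℕ) : Prop :=
  (∃ B : ℝ, (∀ a ∈ A, ∀ l, |mu0 a l| ≤ B) ∧
      ∀ N, ∀ s ∈ Finset.Icc 1 (T N), ∀ a ∈ A, |p N s a| ≤ B) ∧
    (∃ L0 : ℝ, ∀ a ∈ A, ∀ b ∈ A, ∀ l, |mu0 a l - mu0 b l| ≤ L0 * ‖a - b‖) ∧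
    ∃ Lp : ℝ, ∀ N, ∀ s ∈ Finset.Icc 1 (T N), ∀ a ∈ A, ∀ b ∈ A,
      |p N s a - p N s b| ≤ Lp * ‖a - b‖

/-- A kernel on `[0, ∞)`: nonnegative, positive at zero, of compact support, bounded and
Lipschitz. Only the values on `[0, ∞)` matter. -/
structure IsKernel (K : ℝ → ℝ) : Prop where
  nonneg : ∀ z, 0 ≤ z → 0 ≤ K z
  pos_zero : 0 < K 0
  compact_support : ∃ R : ℝ, ∀ z, R < z → K z = 0
  bounded : ∃ B : ℝ, ∀ z, 0 ≤ z → K z ≤ B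
  lipschitz : ∃ B : ℝ, ∀ z z', 0 ≤ z → 0 ≤ z' → |K z - K z'| ≤ B * |z - z'|

/-- The two lower bounds which make the population pseudo-distance informative about the
individual factors. -/
def DistanceConditions {d : ℕ} {L : Type*} [MeasurableSpace L] (A : Set (Vec d))
    (mu0 : Vec d → L → ℝ) (ν : Measure (Vec d)) (π : Measure L) : Prop :=
  ∃ c₁ c₂ : ℝ, 0 < c₁ ∧ 0 < c₂ ∧ ∀ a ∈ A, ∀ b ∈ A,
    c₁ * ‖a - b‖ ^ 2 ≤ ∫ l, (mu0 a l - mu0 b l) ^ 2 ∂π ∧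
    c₂ * √(∫ l, (mu0 a l - mu0 b l) ^ 2 ∂π) ≤
      ⨆ e : ν.support, ∫ l, mu0 e l * (mu0 a l - mu0 b l) ∂π

/-- `Z_N = O_p(r_N)` as `N → ∞`, where `Z_N` is a random variable on the `N`-th probability
space. -/
def IsBigOInProb {Ω : ℕ → Type*} [∀ N, MeasurableSpace (Ω N)] (P : ∀ N, Measure (Ω N))
    (Z : ∀ N, Ω N → ℝ) (r : ℕ → ℝ) : Prop :=
  ∀ ε : ℝ, 0 < ε → ∃ M : ℝ, ∀ᶠ N in atTop, (P N).real {ω | M * r N < |Z N ω|} ≤ ε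

end LatentPanel

/-!
The estimators are kernel averages over the pseudo-distance `d̂ i j`, so everything rests on
comparing `d̂ i j` with `‖α i - α j‖` and on the kernel weights being independent of the residuals
of period `t`.

**The pseudo-distance.** For `k ≠ i` the normalized inner product of the untreated outcome paths of
`k` and `i` is close to `crossMoment (α k) (α i)`, the integral of `μ⁽⁰⁾(α k, ·) μ⁽⁰⁾(α i, ·)`
against the law of the period factors. Hoeffding's inequality over the period factors controls the
signal, and over the residuals given all latent factors the noise (`measureReal_cross_le`); the
maximum in `d̂ i j` omits `k = i, j`, so the variance term `∑ u²` never enters. A fluctuation of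
order `√(log N / T₀)` survives the union over all pairs, and it is of smaller order than `h`. Hence
`d̂ i j ≤ B L₀ ‖α i - α j‖ + o(h)` by the Lipschitz property of `μ⁽⁰⁾`
(`TypicalSample.pseudoDist_le`). Conversely some point `e` of the support of `α` separates `α i`
from `α j`. The separation persists in a ball around `e` whose radius depends neither on `i, j` nor
on `N` (`exists_crossMoment_separation`), and a finite net of such balls is visited by more than
two individuals with probability tending to one, so `‖α i - α j‖ ≤ C d̂ i j + o(h)`
(`TypicalSample.norm_sub_le_pseudoDist`). In particular individuals with positive weight are within
`O(h)` of each other, which bounds the bias by the Lipschitz property of `μ⁽⁰⁾` and `p`.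

**The kernel averages.** By a Chernoff bound every individual has of the order of `h ^ d N`
neighbours within a small multiple of `h`, all of which receive weight at least `K(0) / 2`, so
the total weight is at least of that order (`TypicalSample.le_sum_kernel`). Given the latent
factors, the weights are functions of the pre-treatment residuals, hence independent of the
residuals of period `t`. Hoeffding's inequality given the weights bounds the weighted noise by
`√(log N)` times the Euclidean norm of the weights. As the weights are bounded, that norm is at
most a constant times the square root of the total weight, and division by the total weight leaves
`√(log N / (h ^ d N))`. For the outcomes the weights are restricted to the untreated; overlap keeps
a fixed fraction of the weight there, and unconfoundedness keeps `(1 - w) u` sub-Gaussian.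

All deterministic conclusions are drawn from the structure `TypicalSample`, whose failure
probability is estimated in `measureReal_not_typicalSample_le`. Conditioning is carried out with
the regular conditional distribution given the latent factors: almost surely it turns the
conditional hypotheses into ordinary ones, collected in `ConditionalDesign`.
-/

namespace LatentPanel

/-! ### Conditioning: passing to the regular conditional probabilities -/

section Conditioning

/-- For variables with countably generated target σ-algebras the exceptional null set in
`Kernel.iIndepFun` can be chosen independently of the events. -/
theorem ae_iIndepFun_of_kernel {Ω Ω' : Type*} {mΩ : MeasurableSpace Ω} {mΩ' : MeasurableSpace Ω'}
    {ι : Type*} [Finite ι] {β : ι → Type*}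
    [∀ i, MeasurableSpace (β i)] [∀ i, MeasurableSpace.CountablyGenerated (β i)]
    {κ : Kernel Ω' Ω} {μ : Measure Ω'} {f : ∀ i, Ω → β i} (hf : ∀ i, Measurable (f i))
    (h : Kernel.iIndepFun f κ μ) : ∀ᵐ a ∂μ, iIndepFun f (κ a) := by
  classical
  have := Fintype.ofFinite ι
  let G : ∀ i, Set (Set (β i)) := fun i =>
    generateSetAlgebra (MeasurableSpace.countableGeneratingSet (β i))
  have hGc : ∀ i, Countable (G i) := fun i =>
    (countable_generateSetAlgebra MeasurableSpace.countable_countableGeneratingSet).to_subtype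
  have hGg : ∀ i, MeasurableSpace.generateFrom (G i) = ‹∀ i, MeasurableSpace (β i)› i := fun i => by
    rw [generateFrom_generateSetAlgebra_eq, MeasurableSpace.generateFrom_countableGeneratingSet]
  have hGm : ∀ i, ∀ s ∈ G i, MeasurableSet s := fun i s hs => by
    rw [← hGg i]; exact MeasurableSpace.measurableSet_generateFrom hs
  have hall : ∀ᵐ a ∂μ, ∀ (S : Finset ι) (s : ∀ i, G i),
      κ a (⋂ i ∈ S, f i ⁻¹' (s i : Set (β i))) = ∏ i ∈ S, κ a (f i ⁻¹' (s i : Set (β i))) := by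
    rw [ae_all_iff]; intro S
    rw [ae_all_iff]; intro s
    exact h.meas_biInter fun i _ => ⟨_, hGm i _ (s i).2, rfl⟩
  filter_upwards [hall] with a ha
  rw [iIndepFun_iff_iIndep]
  refine iIndepSets.iIndep (fun i => (hf i).comap_le)
    (fun i => {u | ∃ s ∈ G i, f i ⁻¹' s = u}) (fun i => ?_) (fun i => ?_) ?_
  · rintro _ ⟨s, hs, rfl⟩ _ ⟨u, hu, rfl⟩ -
    exact ⟨s ∩ u, isSetAlgebra_generateSetAlgebra.inter_mem hs hu, rfl⟩
  · rw [← hGg i, MeasurableSpace.comap_generateFrom]; rfl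
  · rw [iIndepSets_iff]
    intro S u hu
    choose! s hs hsu using hu
    have hne : ∀ i, Set.univ ∈ G i := fun i => isSetAlgebra_generateSetAlgebra.univ_mem
    have := ha S (fun i => if hi : i ∈ S then ⟨s i, hs i hi⟩ else ⟨_, hne i⟩)
    rw [show (⋂ i ∈ S, u i) = ⋂ i ∈ S, f i ⁻¹'
        ((if hi : i ∈ S then ⟨s i, hs i hi⟩ else ⟨_, hne i⟩ : G i) : Set (β i)) from
      Set.iInter₂_congr fun i hi => by simp [hi, hsu i hi], this]
    exact Finset.prod_congr rfl fun i hi => by simp [hi, hsu i hi]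

variable {Ω : Type*} {m : MeasurableSpace Ω} {mΩ : MeasurableSpace Ω} [StandardBorelSpace Ω]
  {P : Measure Ω} [IsFiniteMeasure P]

/-- Conditionally on `m`, an `m`-measurable real variable is almost surely constant. -/
theorem ae_ae_eq_condExpKernel (hm : m ≤ mΩ) {f : Ω → ℝ} (hf : Measurable[m] f) :
    ∀ᵐ ω ∂P, ∀ᵐ ω' ∂condExpKernel P m ω, f ω' = f ω := by
  have hS : MeasurableSet[m.prod mΩ] {x : Ω × Ω | f x.2 = f x.1} := by
    let _ : MeasurableSpace (Ω × Ω) := m.prod mΩ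
    refine measurableSet_eq_fun (f := fun x : Ω × Ω => f x.2) (g := fun x : Ω × Ω => f x.1) ?_ ?_
    · exact (hf.mono hm le_rfl).comp (@measurable_snd Ω Ω m mΩ)
    · exact hf.comp (@measurable_fst Ω Ω m mΩ)
  have h1 : ∀ᵐ x ∂((P.trim hm) ⊗ₘ condExpKernel P m), f x.2 = f x.1 := by
    rw [compProd_trim_condExpKernel hm]
    rw [@ae_map_iff Ω (Ω × Ω) mΩ (m.prod mΩ) P _ ?_ _ hS]
    · simp [Function.diag]
    · exact @Measurable.aemeasurable Ω (Ω × Ω) mΩ (m.prod mΩ) _ _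
        (@Measurable.prodMk Ω mΩ Ω Ω m mΩ _ _ (measurable_id'' hm) measurable_id)
  exact ae_of_ae_trim hm (Measure.ae_ae_of_ae_compProd h1)

/-- An event that is almost surely at most `b`-likely given `m` has probability at most `b`. -/
theorem measureReal_le_of_condExpKernel [IsProbabilityMeasure P] (hm : m ≤ mΩ) {E : Set Ω}
    (hE : MeasurableSet E) {b : ℝ} (hb : 0 ≤ b)
    (h : ∀ᵐ ω ∂P, (condExpKernel P m ω).real E ≤ b) : P.real E ≤ b := by
  refine ENNReal.toReal_le_of_le_ofReal hb ?_
  have h0 : P E = ∫⁻ ω, condExpKernel P m ω E ∂P := by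
    conv_lhs => rw [← condExpKernel_comp_trim (μ := P) hm]
    rw [Measure.bind_apply hE (Kernel.aemeasurable _)]
    exact lintegral_trim hm (measurable_condExpKernel hE)
  rw [h0]
  calc ∫⁻ ω, condExpKernel P m ω E ∂P ≤ ∫⁻ _, ENNReal.ofReal b ∂P := by
        refine lintegral_mono_ae ?_
        filter_upwards [h] with ω hω
        rw [← ofReal_measureReal]
        exact ENNReal.ofReal_le_ofReal hω
    _ = ENNReal.ofReal b := by simp

/-- An almost sure event is almost surely of full conditional probability. -/
theorem ae_ae_condExpKernel (hm : m ≤ mΩ) {p : Ω → Prop} (h : ∀ᵐ ω ∂P, p ω) :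
    ∀ᵐ ω ∂P, ∀ᵐ ω' ∂condExpKernel P m ω, p ω' := by
  rw [← condExpKernel_comp_trim (μ := P) hm] at h
  exact ae_of_ae_trim hm (Measure.ae_ae_of_ae_comp h)

end Conditioning

/-! ### Concentration inequalities -/

section Concentration

variable {Ω : Type*} {mΩ : MeasurableSpace Ω} {Q : Measure Ω} [IsProbabilityMeasure Q]

/-- Fubini for independent variables: an event in terms of `(X, Y)` that is at most `b`-likely for
almost every frozen value of `X` has probability at most `b`. -/
theorem measureReal_le_of_indepFun {β γ : Type*} [MeasurableSpace β] [MeasurableSpace γ]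
    {X : Ω → β} {Y : Ω → γ} (hX : Measurable X) (hY : Measurable Y) (hXY : IndepFun X Y Q)
    {S : Set (β × γ)} (hS : MeasurableSet S) {b : ℝ} (hb : 0 ≤ b)
    (h : ∀ᵐ ω ∂Q, Q.real {ω' | (X ω, Y ω') ∈ S} ≤ b) :
    Q.real {ω | (X ω, Y ω) ∈ S} ≤ b := by
  refine ENNReal.toReal_le_of_le_ofReal hb ?_
  have h0 : Q {ω | (X ω, Y ω) ∈ S} = ∫⁻ ω, Q {ω' | (X ω, Y ω') ∈ S} ∂Q := by
    have h1 : Q {ω | (X ω, Y ω) ∈ S} = (Q.map fun ω => (X ω, Y ω)) S := by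
      rw [Measure.map_apply (hX.prodMk hY) hS]; rfl
    rw [h1, (indepFun_iff_map_prod_eq_prod_map_map hX.aemeasurable hY.aemeasurable).1 hXY]
    have : IsProbabilityMeasure (Q.map Y) := Measure.isProbabilityMeasure_map hY.aemeasurable
    rw [Measure.prod_apply hS, lintegral_map (measurable_measure_prodMk_left hS) hX]
    refine lintegral_congr fun ω => ?_
    rw [Measure.map_apply hY (measurable_prodMk_left hS)]; rfl
  rw [h0]
  calc _ ≤ ∫⁻ _, ENNReal.ofReal b ∂Q := by
        refine lintegral_mono_ae ?_
        filter_upwards [h] with ω hω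
        rw [← ofReal_measureReal]
        exact ENNReal.ofReal_le_ofReal hω
    _ = ENNReal.ofReal b := by simp

/-- Hoeffding's inequality, normalized by the Euclidean norm of the coefficients. For `c = 0` the
exponent is `0` and the bound is trivial. -/
theorem measureReal_weighted_sum_le {ι : Type*} [Fintype ι] {ξ : ι → Ω → ℝ} {c : ℝ≥0}
    (hξ : iIndepFun ξ Q) (hsub : ∀ i, HasSubgaussianMGF (ξ i) c Q) (a : ι → ℝ) {y : ℝ}
    (hy : 0 ≤ y) :
    Q.real {ω | y * √(∑ i, a i ^ 2) < |∑ i, a i * ξ i ω|} ≤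
      2 * Real.exp (-y ^ 2 / (2 * c)) := by
  have hpos : 0 ≤ ∑ i, a i ^ 2 := Finset.sum_nonneg fun i _ => sq_nonneg _
  have hsum : HasSubgaussianMGF (fun ω => ∑ i, a i * ξ i ω)
      (∑ i, (⟨a i ^ 2, sq_nonneg _⟩ * c : ℝ≥0)) Q :=
    HasSubgaussianMGF.sum_of_iIndepFun
      (hξ.comp (fun i x => a i * x) fun i => measurable_const_mul (a i))
      fun i _ => (hsub i).const_mul (a i)
  have hcoe : ((∑ i, (⟨a i ^ 2, sq_nonneg _⟩ * c : ℝ≥0) : ℝ≥0) : ℝ) = (∑ i, a i ^ 2) * c := by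
    push_cast
    rw [Finset.sum_mul]
    rfl
  rcases hpos.eq_or_lt with h0 | h0
  · have ha : ∀ i, a i = 0 := fun i => by
      have := (Finset.sum_eq_zero_iff_of_nonneg (fun i _ => sq_nonneg (a i))).1 h0.symm i
        (Finset.mem_univ i)
      exact pow_eq_zero_iff two_ne_zero |>.1 this
    simp only [ha]
    simp
    positivity
  · have hexp : -(y * √(∑ i, a i ^ 2)) ^ 2 / (2 * ((∑ i, a i ^ 2) * (c : ℝ))) =
        -y ^ 2 / (2 * c) := by
      rw [mul_pow, Real.sq_sqrt hpos]
      have := h0.ne'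
      by_cases hc : (c : ℝ) = 0
      · simp [hc]
      · field_simp
    have h1 := hsum.measure_ge_le (mul_nonneg hy (Real.sqrt_nonneg (∑ i, a i ^ 2)))
    have h2 := hsum.neg.measure_ge_le (mul_nonneg hy (Real.sqrt_nonneg (∑ i, a i ^ 2)))
    rw [hcoe, hexp] at h1 h2
    calc _ ≤ Q.real ({ω | y * √(∑ i, a i ^ 2) ≤ ∑ i, a i * ξ i ω} ∪
          {ω | y * √(∑ i, a i ^ 2) ≤ (-fun ω => ∑ i, a i * ξ i ω) ω}) := by
          refine measureReal_mono fun ω hω => ?_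
          have hω' : y * √(∑ i, a i ^ 2) < |∑ i, a i * ξ i ω| := hω
          rcases lt_abs.1 hω' with h | h
          · exact Or.inl h.le
          · exact Or.inr (by simpa using h.le)
      _ ≤ _ := (measureReal_union_le _ _).trans (by linarith)

/-- Hoeffding's inequality with random weights `W` that are independent of the summands: by
conditioning on `W` the bound for fixed weights carries over. -/
theorem measureReal_random_weighted_sum_le {ι : Type*} [Fintype ι] {W ξ : ι → Ω → ℝ}
    {c : ℝ≥0} (hW : ∀ i, Measurable (W i)) (hξm : ∀ i, Measurable (ξ i)) (hξ : iIndepFun ξ Q)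
    (hsub : ∀ i, HasSubgaussianMGF (ξ i) c Q)
    (hind : IndepFun (fun ω i => W i ω) (fun ω i => ξ i ω) Q) {y : ℝ} (hy : 0 ≤ y) :
    Q.real {ω | y * √(∑ i, W i ω ^ 2) < |∑ i, W i ω * ξ i ω|} ≤
      2 * Real.exp (-y ^ 2 / (2 * c)) := by
  refine measureReal_le_of_indepFun (measurable_pi_lambda _ hW) (measurable_pi_lambda _ hξm) hind
    (S := {x | y * √(∑ i, x.1 i ^ 2) < |∑ i, x.1 i * x.2 i|}) ?_ (by positivity)
    (ae_of_all _ fun ω => measureReal_weighted_sum_le hξ hsub _ hy)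
  exact measurableSet_lt (by fun_prop) (by fun_prop)

/-- Squares of sub-Gaussian variables have a finite exponential moment: `exp (x ^ 2 / (4 c))` is
the integral of `exp (√(1 / (2 c)) * g * x)` over a standard Gaussian `g`, so Tonelli's theorem
reduces the claim to the sub-Gaussian bound. -/
theorem lintegral_exp_sq_le {X : Ω → ℝ} (hXm : Measurable X) {c : ℝ≥0} (hc : c ≠ 0)
    (hX : HasSubgaussianMGF X c Q) :
    ∫⁻ ω, ENNReal.ofReal (Real.exp (X ω ^ 2 / (4 * c))) ∂Q ≤ ENNReal.ofReal (√2) := by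
  have hc' : (0 : ℝ) < c := by positivity
  have hr : √(1 / (2 * (c : ℝ))) ^ 2 = 1 / (2 * c) := Real.sq_sqrt (by positivity)
  set r : ℝ := √(1 / (2 * (c : ℝ))) with hrdef
  have hg : ∀ z : ℝ, ∫⁻ g, ENNReal.ofReal (Real.exp (z * g)) ∂(gaussianReal 0 1) =
      ENNReal.ofReal (Real.exp (z ^ 2 / 2)) := fun z => by
    rw [← ofReal_integral_eq_lintegral_ofReal (integrable_exp_mul_gaussianReal z)
      (ae_of_all _ fun _ => (Real.exp_pos _).le)]
    have := mgf_gaussianReal (p := gaussianReal 0 1) (X := id) (μ := 0) (v := 1) (by simp) z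
    simp only [mgf, id] at this
    rw [this]; simp
  calc ∫⁻ ω, ENNReal.ofReal (Real.exp (X ω ^ 2 / (4 * c))) ∂Q
      = ∫⁻ ω, ∫⁻ g, ENNReal.ofReal (Real.exp (r * X ω * g)) ∂(gaussianReal 0 1) ∂Q := by
        refine lintegral_congr fun ω => ?_
        rw [hg, mul_pow, hr]; congr 2; field_simp; ring
    _ = ∫⁻ g, ∫⁻ ω, ENNReal.ofReal (Real.exp (r * X ω * g)) ∂Q ∂(gaussianReal 0 1) :=
        lintegral_lintegral_swap (by fun_prop)
    _ ≤ ∫⁻ g, ENNReal.ofReal (Real.exp (g ^ 2 / 4)) ∂(gaussianReal 0 1) := by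
        refine lintegral_mono fun g => ?_
        have h1 := hX.mgf_le (r * g)
        have h2 := hX.integrable_exp_mul (r * g)
        have h3 : ∀ ω, r * X ω * g = r * g * X ω := fun ω => by ring
        simp only [h3]
        rw [← ofReal_integral_eq_lintegral_ofReal h2 (ae_of_all _ fun _ => (Real.exp_pos _).le)]
        refine ENNReal.ofReal_le_ofReal (h1.trans (Real.exp_le_exp.2 ?_))
        rw [mul_pow, hr]; apply le_of_eq; field_simp; ring
    _ = ENNReal.ofReal (√2) := by
        rw [gaussianReal_of_var_ne_zero _ one_ne_zero,
          lintegral_withDensity_eq_lintegral_mul _ (measurable_gaussianPDF _ _) (by fun_prop)]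
        have h4 : ∀ g : ℝ, (gaussianPDF 0 1 * fun g => ENNReal.ofReal (Real.exp (g ^ 2 / 4))) g =
            ENNReal.ofReal ((√(2 * Real.pi))⁻¹ * Real.exp (-(1 / 4) * g ^ 2)) := fun g => by
          simp only [Pi.mul_apply, gaussianPDF, gaussianPDFReal]
          rw [← ENNReal.ofReal_mul (by positivity), mul_assoc, ← Real.exp_add]
          congr 2
          · simp
          · congr 1; simp; ring
        simp only [h4]
        rw [← ofReal_integral_eq_lintegral_ofReal
          ((integrable_exp_neg_mul_sq (by norm_num)).const_mul _)
          (ae_of_all _ fun _ => by positivity), integral_const_mul, integral_gaussian]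
        congr 1
        rw [← Real.sqrt_inv, ← Real.sqrt_mul (by positivity)]
        congr 1
        field_simp; norm_num

/-- The sum of squares of `n` independent sub-Gaussian variables exceeds a fixed multiple of `n`
only with exponentially small probability. -/
theorem measureReal_sum_sq_le {ι : Type*} [Fintype ι] {ξ : ι → Ω → ℝ} {c : ℝ≥0} (hc : c ≠ 0)
    (hξm : ∀ i, Measurable (ξ i)) (hξ : iIndepFun ξ Q)
    (hsub : ∀ i, HasSubgaussianMGF (ξ i) c Q) :
    Q.real {ω | 8 * c * Fintype.card ι < ∑ i, ξ i ω ^ 2} ≤ Real.exp (-Fintype.card ι) := by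
  have hc' : (0 : ℝ) < c := by positivity
  let Z : ι → Ω → ℝ := fun i ω => ξ i ω ^ 2 / (4 * c)
  have hZm : ∀ i, Measurable (Z i) := fun i => by fun_prop
  have hZ : iIndepFun Z Q := hξ.comp (fun _ x => x ^ 2 / (4 * (c : ℝ))) fun _ => by fun_prop
  have hint : ∀ i, Integrable (fun ω => Real.exp (1 * Z i ω)) Q := fun i => by
    refine ⟨by fun_prop, ?_⟩
    rw [hasFiniteIntegral_iff_ofReal (ae_of_all _ fun _ => (Real.exp_pos _).le)]
    simp only [one_mul]
    exact (lintegral_exp_sq_le (hξm i) hc (hsub i)).trans_lt ENNReal.ofReal_lt_top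
  have hmgf : ∀ i, mgf (Z i) Q 1 ≤ Real.exp 1 := fun i => by
    have h1 : mgf (Z i) Q 1 ≤ √2 := by
      rw [mgf, integral_eq_lintegral_of_nonneg_ae (ae_of_all _ fun _ => (Real.exp_pos _).le)
        (hint i).1]
      simp only [one_mul]
      exact ENNReal.toReal_le_of_le_ofReal (by positivity)
        (lintegral_exp_sq_le (hξm i) hc (hsub i))
    refine h1.trans ?_
    have : √2 ≤ 2 := Real.sqrt_le_iff.2 ⟨by norm_num, by norm_num⟩
    linarith [Real.add_one_le_exp (1 : ℝ)]
  have hch := measure_ge_le_exp_mul_mgf (μ := Q) (X := ∑ i, Z i) (2 * Fintype.card ι) zero_le_one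
    (hZ.integrable_exp_mul_sum hZm fun i _ => hint i)
  rw [hZ.mgf_sum hZm] at hch
  calc _ ≤ Q.real {ω | 2 * (Fintype.card ι : ℝ) ≤ (∑ i, Z i) ω} := by
        refine measureReal_mono fun ω hω => ?_
        simp only [Set.mem_ofPred_eq, Finset.sum_apply, Z] at hω ⊢
        rw [← Finset.sum_div, le_div_iff₀ (by positivity)]
        linarith
    _ ≤ Real.exp (-1 * (2 * Fintype.card ι)) * ∏ i : ι, mgf (Z i) Q 1 := hch
    _ ≤ Real.exp (-1 * (2 * Fintype.card ι)) * Real.exp 1 ^ Fintype.card ι := by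
        gcongr
        calc ∏ i : ι, mgf (Z i) Q 1 ≤ ∏ _i : ι, Real.exp 1 :=
              Finset.prod_le_prod (fun _ _ => mgf_nonneg) fun i _ => hmgf i
          _ = _ := by simp
    _ = Real.exp (-Fintype.card ι) := by
        rw [← Real.exp_nat_mul, ← Real.exp_add]; congr 1; ring

/-- Multiplicative Chernoff bound: among independent variables with law `ν`, at least a quarter of
the expected number falls into a given set, up to an exponentially small probability. -/
theorem measureReal_count_le {ι E : Type*} [Fintype ι] [MeasurableSpace E] {ν : Measure E}
    {X : ι → Ω → E} (hXm : ∀ i, Measurable (X i)) (hX : iIndepFun X Q)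
    (hlaw : ∀ i, Q.map (X i) = ν) {B : Set E} (hB : MeasurableSet B) (S : Finset ι) {q : ℝ}
    (hq : q ≤ ν.real B) :
    Q.real {ω | ∑ i ∈ S, B.indicator (fun _ => (1 : ℝ)) (X i ω) ≤ S.card * q / 4} ≤
      Real.exp (-(S.card * q / 4)) := by
  classical
  let Z : ι → Ω → ℝ := fun i ω => B.indicator (fun _ => (1 : ℝ)) (X i ω)
  have hBm : Measurable (B.indicator fun _ => (1 : ℝ)) := measurable_const.indicator hB
  have hZm : ∀ i, Measurable (Z i) := fun i => hBm.comp (hXm i)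
  have hZ : iIndepFun Z Q := hX.comp (fun _ => B.indicator fun _ => (1 : ℝ)) fun _ => hBm
  have hexp : ∀ i, (fun ω => Real.exp (-1 * Z i ω)) =
      fun ω => 1 - (1 - Real.exp (-1)) * (X i ⁻¹' B).indicator (fun _ => (1 : ℝ)) ω := fun i => by
    ext ω
    by_cases h : X i ω ∈ B
    · simp [Z, Set.indicator, h]
    · simp [Z, Set.indicator, h]
  have hI : ∀ i, Integrable ((X i ⁻¹' B).indicator (fun _ => (1 : ℝ))) Q := fun i =>
    (integrable_const _).indicator (hXm i hB)
  have hint : ∀ i, Integrable (fun ω => Real.exp (-1 * Z i ω)) Q := fun i => by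
    rw [hexp i]
    exact (integrable_const _).sub ((hI i).const_mul _)
  have he : Real.exp (-1) ≤ 1 / 2 := by
    rw [Real.exp_neg, inv_le_comm₀ (Real.exp_pos _) (by norm_num)]
    linarith [Real.add_one_le_exp (1 : ℝ)]
  have hmgf : ∀ i, mgf (Z i) Q (-1) ≤ Real.exp (-(q / 2)) := fun i => by
    have h1 : mgf (Z i) Q (-1) = 1 - (1 - Real.exp (-1)) * ν.real B := by
      rw [mgf, hexp i, integral_sub (integrable_const _) ((hI i).const_mul _),
        integral_const_mul, integral_indicator_const _ (hXm i hB), ← hlaw i,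
        map_measureReal_apply (hXm i) hB]
      simp
    rw [h1]
    have h0 : 0 ≤ ν.real B := measureReal_nonneg
    nlinarith [Real.add_one_le_exp (-(q / 2))]
  have hch := measure_le_le_exp_mul_mgf (μ := Q) (X := ∑ i ∈ S, Z i) (t := -1)
    (S.card * q / 4) (by norm_num) (hZ.integrable_exp_mul_sum hZm fun i _ => hint i)
  rw [hZ.mgf_sum hZm] at hch
  calc _ = Q.real {ω | (∑ i ∈ S, Z i) ω ≤ S.card * q / 4} := by
        simp only [Finset.sum_apply, Z]
    _ ≤ Real.exp (-(-1) * (S.card * q / 4)) * ∏ i ∈ S, mgf (Z i) Q (-1) := hch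
    _ ≤ Real.exp (-(-1) * (S.card * q / 4)) * Real.exp (-(q / 2)) ^ S.card := by
        gcongr
        calc ∏ i ∈ S, mgf (Z i) Q (-1) ≤ ∏ _i ∈ S, Real.exp (-(q / 2)) :=
              Finset.prod_le_prod (fun _ _ => mgf_nonneg) fun i _ => hmgf i
          _ = _ := by simp
    _ = Real.exp (-(S.card * q / 4)) := by
        rw [← Real.exp_nat_mul, ← Real.exp_add]; congr 1; ring

end Concentration

/-! ### The panel given the latent factors -/

theorem measurable_pseudoDist {N : ℕ} (T0 : ℕ) (i j : Fin N) :
    Measurable fun y : Fin N → ℕ → ℝ => pseudoDist T0 y i j := by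
  unfold pseudoDist
  refine Measurable.const_mul (Measurable.iSup fun k => ?_) _
  fun_prop

theorem pseudoDist_congr {N T0 : ℕ} {y y' : Fin N → ℕ → ℝ}
    (h : ∀ i, ∀ s ∈ Finset.Icc 1 T0, y i s = y' i s) (i j : Fin N) :
    pseudoDist T0 y i j = pseudoDist T0 y' i j := by
  unfold pseudoDist
  congr 2
  ext k
  congr 1
  refine Finset.sum_congr rfl fun s hs => ?_
  rw [h _ s hs, h _ s hs, h _ s hs]

theorem _root_.ProbabilityTheory.HasSubgaussianMGF.mono {Ω : Type*} {mΩ : MeasurableSpace Ω}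
    {Q : Measure Ω} {X : Ω → ℝ} {c c' : ℝ≥0} (h : HasSubgaussianMGF X c Q) (hc : c ≤ c') :
    HasSubgaussianMGF X c' Q where
  integrable_exp_mul := h.integrable_exp_mul
  mgf_le z := (h.mgf_le z).trans (Real.exp_le_exp.2 (by gcongr))

/-- Multiplying a sub-Gaussian variable by an independent indicator keeps it sub-Gaussian. -/
theorem hasSubgaussianMGF_indicator_mul {Ω : Type*} {mΩ : MeasurableSpace Ω} {Q : Measure Ω}
    [IsProbabilityMeasure Q] {V U : Ω → ℝ} (hVm : Measurable V) (hUm : Measurable U) {c : ℝ≥0}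
    (hV : ∀ᵐ ω ∂Q, V ω = 0 ∨ V ω = 1)
    (hU : HasSubgaussianMGF U c Q) (hind : IndepFun V U Q) :
    HasSubgaussianMGF (fun ω => V ω * U ω) c Q := by
  have heq : ∀ z : ℝ, (fun ω => Real.exp (z * (V ω * U ω))) =ᵐ[Q]
      fun ω => (1 - V ω) + V ω * Real.exp (z * U ω) := fun z => by
    filter_upwards [hV] with ω h
    rcases h with h | h <;> simp [h]
  have hVint : Integrable V Q :=
    Integrable.of_mem_Icc 0 1 hVm.aemeasurable (by
      filter_upwards [hV] with ω h
      rcases h with h | h <;> simp [h])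
  have hind' : ∀ z : ℝ, IndepFun V (fun ω => Real.exp (z * U ω)) Q := fun z =>
    hind.comp (φ := id) (ψ := fun x => Real.exp (z * x)) measurable_id (by fun_prop)
  have hprod : ∀ z : ℝ, Integrable (fun ω => V ω * Real.exp (z * U ω)) Q := fun z =>
    (hind' z).integrable_mul hVint (hU.integrable_exp_mul z)
  have h1V : Integrable (fun ω => 1 - V ω) Q := (integrable_const 1).sub hVint
  refine ⟨fun z => (h1V.add (hprod z)).congr (heq z).symm, fun z => ?_⟩
  have hE0 : 0 ≤ ∫ ω, V ω ∂Q := integral_nonneg_of_ae (by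
    filter_upwards [hV] with ω h
    rcases h with h | h <;> simp [h])
  have hmul : ∫ ω, V ω * Real.exp (z * U ω) ∂Q = (∫ ω, V ω ∂Q) * mgf U Q z :=
    (hind' z).integral_mul_eq_mul_integral hVm.aestronglyMeasurable (by fun_prop)
  have hE1 : ∫ ω, V ω ∂Q ≤ 1 := by
    calc ∫ ω, V ω ∂Q ≤ ∫ _, (1 : ℝ) ∂Q := integral_mono_ae hVint (integrable_const _) (by
          filter_upwards [hV] with ω h
          rcases h with h | h <;> simp [h])
      _ = 1 := by simp
  rw [mgf, integral_congr_ae (heq z), integral_add h1V (hprod z), hmul,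
    integral_sub (integrable_const _) hVint]
  have h2 := hU.mgf_le z
  have h3 : 1 ≤ Real.exp (c * z ^ 2 / 2) := Real.one_le_exp (by positivity)
  simp only [integral_const, probReal_univ, smul_eq_mul, mul_one]
  nlinarith

/-- The properties of a panel under its regular conditional distribution `Q` given the latent
factors: the conditional means `m i s` and `q i` of the outcomes and of the treatment are constant,
and the residuals are independent across individuals and periods and sub-Gaussian with variance
proxy `c`. Only the periods `1, …, T0` and `t` matter. -/
structure ConditionalDesign {Ω : Type*} [MeasurableSpace Ω] {d : ℕ} {L : Type*}
    [MeasurableSpace L] {N : ℕ} (X : Panel Ω d L N) (Q : Measure Ω) (T0 t : ℕ)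
    (mu0 : Vec d → L → ℝ) (p : ℕ → Vec d → ℝ) (c : ℝ≥0) (m : Fin N → ℕ → ℝ) (q : Fin N → ℝ) :
    Prop where
  mean_outcome : ∀ i, ∀ s ∈ insert t (Finset.Icc 1 T0),
    ∀ᵐ ω ∂Q, mu0 (X.α i ω) (X.lam s ω) = m i s
  mean_treatment : ∀ i, ∀ᵐ ω ∂Q, p t (X.α i ω) = q i
  subgaussian_u : ∀ i, ∀ s ∈ insert t (Finset.Icc 1 T0), HasSubgaussianMGF (X.u mu0 i s) c Q
  subgaussian_eps : ∀ i, HasSubgaussianMGF (X.eps p i t) c Q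
  indep : iIndepFun (fun (r : Fin N × ↥(insert t (Finset.Icc 1 T0))) (ω : Ω) =>
    (X.u mu0 r.1 r.2 ω, X.eps p r.1 r.2 ω)) Q
  binary : ∀ i, ∀ᵐ ω ∂Q, X.w i t ω = 0 ∨ X.w i t ω = 1
  unconfounded : ∀ i, IndepFun (X.Y0 i t) (X.w i t) Q

section

variable {Ω : Type*} [mΩ : MeasurableSpace Ω] {d : ℕ} {L : Type*} [MeasurableSpace L] {N : ℕ}
  {X : Panel Ω d L N} {mu0 : Vec d → L → ℝ} {p : ℕ → Vec d → ℝ}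

theorem Panel.measurable_mean (X : Panel Ω d L N) (hmu0 : Measurable (Function.uncurry mu0))
    (i : Fin N) (s : ℕ) : Measurable fun ω => mu0 (X.α i ω) (X.lam s ω) :=
  hmu0.comp ((X.measurable_α i).prodMk (X.measurable_lam s))

theorem Panel.measurable_u (X : Panel Ω d L N) (hmu0 : Measurable (Function.uncurry mu0))
    (i : Fin N) (s : ℕ) : Measurable (X.u mu0 i s) :=
  (X.measurable_Y0 i s).sub (X.measurable_mean hmu0 i s)

theorem Panel.measurable_eps (X : Panel Ω d L N) (hp : ∀ s, Measurable (p s))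
    (i : Fin N) (s : ℕ) : Measurable (X.eps p i s) :=
  (X.measurable_w i s).sub ((hp s).comp (X.measurable_α i))

theorem Panel.measurable_latent_α (X : Panel Ω d L N) (T : ℕ) (i : Fin N) :
    Measurable[X.latent T] (X.α i) :=
  (comap_measurable (X.α i)).mono (le_sup_of_le_left (le_iSup_of_le i le_rfl)) le_rfl

theorem Panel.measurable_latent_lam (X : Panel Ω d L N) {T s : ℕ} (hs : s ∈ Finset.Icc 1 T) :
    Measurable[X.latent T] (X.lam s) :=
  (comap_measurable (X.lam s)).mono
    (le_sup_of_le_right (le_iSup_of_le (⟨s, hs⟩ : Finset.Icc 1 T) le_rfl)) le_rfl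

/-- Almost every regular conditional distribution given the latent factors satisfies
`ConditionalDesign`. The bound `exp (δ η²)` amounts to the variance proxy `2 * δ`; the summand `1`
only makes the proxy positive. -/
theorem ae_conditionalDesign [StandardBorelSpace Ω] {P : Measure Ω} [IsProbabilityMeasure P]
    {T0 T t : ℕ} (ht : T0 < t ∧ t ≤ T) (hmu0 : Measurable (Function.uncurry mu0))
    (hp : ∀ s, Measurable (p s)) {δ : ℝ≥0}
    (hbin : X.BinaryTreatment P T0 T) (hunc : X.LatentUnconfounded P T)
    (herr : X.ErrorConditions P T0 T t mu0 p δ) :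
    ∀ᵐ ω ∂P, ConditionalDesign X (condExpKernel P (X.latent T) ω) T0 t mu0 p (2 * δ + 1)
      (fun i s => mu0 (X.α i ω) (X.lam s ω)) (fun i => p t (X.α i ω)) := by
  have hI : ∀ s ∈ insert t (Finset.Icc 1 T0), s ∈ Finset.Icc 1 T := fun s hs => by
    simp only [Finset.mem_insert, Finset.mem_Icc] at hs ⊢
    omega
  have htI : t ∈ Finset.Icc 1 T := hI t (Finset.mem_insert_self _ _)
  have hle := X.latent_le T
  have h1 : ∀ i, ∀ s : ↥(insert t (Finset.Icc 1 T0)), ∀ᵐ ω ∂P,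
      ∀ᵐ ω' ∂condExpKernel P (X.latent T) ω,
        mu0 (X.α i ω') (X.lam s ω') = mu0 (X.α i ω) (X.lam s ω) := fun i s =>
    ae_ae_eq_condExpKernel hle
      (hmu0.comp ((X.measurable_latent_α T i).prodMk (X.measurable_latent_lam (hI s s.2))))
  have h2 : ∀ i, ∀ᵐ ω ∂P, ∀ᵐ ω' ∂condExpKernel P (X.latent T) ω,
      p t (X.α i ω') = p t (X.α i ω) := fun i =>
    ae_ae_eq_condExpKernel hle ((hp t).comp (X.measurable_latent_α T i))
  have hsub : ∀ {Z : Ω → ℝ}, HasCondSubgaussianMGF (X.latent T) hle Z (2 * δ) P →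
      ∀ᵐ ω ∂P, HasSubgaussianMGF Z (2 * δ + 1) (condExpKernel P (X.latent T) ω) := fun {Z} hZ => by
    filter_upwards [ae_of_ae_trim hle hZ.mgf_le,
      ae_of_ae_trim hle (Kernel.HasSubgaussianMGF.ae_forall_integrable_exp_mul hZ)] with ω ha hb
    exact HasSubgaussianMGF.mono ⟨hb, ha⟩ le_self_add
  have h3 : ∀ i, ∀ s : ↥(insert t (Finset.Icc 1 T0)), ∀ᵐ ω ∂P,
      HasSubgaussianMGF (X.u mu0 i s) (2 * δ + 1) (condExpKernel P (X.latent T) ω) := fun i s =>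
    hsub (herr.subgaussian_u i s (hI s s.2))
  have h4 : ∀ i, ∀ᵐ ω ∂P,
      HasSubgaussianMGF (X.eps p i t) (2 * δ + 1) (condExpKernel P (X.latent T) ω) := fun i =>
    hsub (herr.subgaussian_eps i t htI)
  have h5 := ae_of_ae_trim hle (ae_iIndepFun_of_kernel
    (f := fun (r : Fin N × ↥(insert t (Finset.Icc 1 T0))) (ω : Ω) =>
      (X.u mu0 r.1 r.2 ω, X.eps p r.1 r.2 ω))
    (fun r => (X.measurable_u hmu0 r.1 r.2).prodMk (X.measurable_eps hp r.1 r.2)) herr.indep)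
  have h6 : ∀ i, ∀ᵐ ω ∂P, ∀ᵐ ω' ∂condExpKernel P (X.latent T) ω,
      X.w i t ω' = 0 ∨ X.w i t ω' = 1 := fun i =>
    ae_ae_condExpKernel hle (hbin.1 i t htI)
  have h7 : ∀ i, ∀ᵐ ω ∂P, IndepFun (X.Y0 i t) (X.w i t) (condExpKernel P (X.latent T) ω) :=
    fun i => by
    have := (condIndepFun_iff_map_prod_eq_prod_map_map (X.measurable_Y0 i t)
      (X.measurable_w i t)).1 (hunc i t htI)
    filter_upwards [ae_of_ae_trim hle this] with ω hω
    rw [indepFun_iff_map_prod_eq_prod_map_map (X.measurable_Y0 i t).aemeasurable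
      (X.measurable_w i t).aemeasurable]
    rw [Kernel.map_apply _ ((X.measurable_Y0 i t).prodMk (X.measurable_w i t)),
      Kernel.prod_apply, Kernel.map_apply _ (X.measurable_Y0 i t),
      Kernel.map_apply _ (X.measurable_w i t)] at hω
    exact hω
  filter_upwards [ae_all_iff.2 fun i => ae_all_iff.2 (h1 i), ae_all_iff.2 h2,
    ae_all_iff.2 fun i => ae_all_iff.2 (h3 i), ae_all_iff.2 h4, h5, ae_all_iff.2 h6,
    ae_all_iff.2 h7] with ω a1 a2 a3 a4 a5 a6 a7
  exact ⟨fun i s hs => a1 i ⟨s, hs⟩, a2, fun i s hs => a3 i ⟨s, hs⟩, a4, a5, a6, a7⟩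

end

/-! ### Deviation bounds given the latent factors -/

/-- Two subfamilies with disjoint index sets of an independent family are independent. -/
theorem _root_.ProbabilityTheory.iIndepFun.indepFun_precomp {Ω ι ι₁ ι₂ β : Type*}
    {mΩ : MeasurableSpace Ω} [Fintype ι] [MeasurableSpace β] {Q : Measure Ω} {f : ι → Ω → β}
    (hf : iIndepFun f Q) (hfm : ∀ i, Measurable (f i)) (g₁ : ι₁ → ι) (g₂ : ι₂ → ι)
    (hg : ∀ a b, g₁ a ≠ g₂ b) :
    IndepFun (fun ω a => f (g₁ a) ω) (fun ω b => f (g₂ b) ω) Q := by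
  classical
  have h := hf.indepFun_finset (Finset.univ.filter fun r => ∃ a, g₁ a = r)
    (Finset.univ.filter fun r => ∃ b, g₂ b = r)
    (by
      rw [Finset.disjoint_filter]
      rintro r - ⟨a, rfl⟩ ⟨b, hb⟩
      exact hg a b hb.symm) hfm
  exact h.comp
    (φ := fun (x : (Finset.univ.filter fun r => ∃ a, g₁ a = r : Finset ι) → β) a =>
      x ⟨g₁ a, by simp⟩)
    (ψ := fun (x : (Finset.univ.filter fun r => ∃ b, g₂ b = r : Finset ι) → β) b =>
      x ⟨g₂ b, by simp⟩)
    (by fun_prop) (by fun_prop)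

section

variable {Ω : Type*} [mΩ : MeasurableSpace Ω] {d : ℕ} {L : Type*} [MeasurableSpace L] {N : ℕ}
  {X : Panel Ω d L N} {mu0 : Vec d → L → ℝ} {p : ℕ → Vec d → ℝ} {Q : Measure Ω}
  {T0 t : ℕ} {c : ℝ≥0} {m : Fin N → ℕ → ℝ} {q : Fin N → ℝ}

namespace ConditionalDesign

theorem iIndepFun_u (hD : ConditionalDesign X Q T0 t mu0 p c m q) (i : Fin N) :
    iIndepFun (fun (s : ↥(Finset.Icc 1 T0)) => X.u mu0 i s) Q := by
  have hinj : Function.Injective (fun s : ↥(Finset.Icc 1 T0) =>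
      ((i, ⟨s, Finset.mem_insert_of_mem s.2⟩) : Fin N × ↥(insert t (Finset.Icc 1 T0)))) := by
    intro a b hab
    exact Subtype.ext (congrArg (fun r => r.2.1) hab)
  exact (hD.indep.precomp hinj).comp (fun _ => Prod.fst) fun _ => measurable_fst

theorem indepFun_u (hD : ConditionalDesign X Q T0 t mu0 p c m q)
    (hmu0 : Measurable (Function.uncurry mu0)) (hp : ∀ s, Measurable (p s)) {k i : Fin N}
    (hki : k ≠ i) :
    IndepFun (fun ω (s : ↥(Finset.Icc 1 T0)) => X.u mu0 k s ω)
      (fun ω (s : ↥(Finset.Icc 1 T0)) => X.u mu0 i s ω) Q := by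
  have h := hD.indep.indepFun_precomp
    (fun r => (X.measurable_u hmu0 r.1 r.2).prodMk (X.measurable_eps hp r.1 r.2))
    (fun s : ↥(Finset.Icc 1 T0) => (k, ⟨s, Finset.mem_insert_of_mem s.2⟩))
    (fun s : ↥(Finset.Icc 1 T0) => (i, ⟨s, Finset.mem_insert_of_mem s.2⟩))
    fun a b hab => hki (congrArg Prod.fst hab)
  exact h.comp (φ := fun x s => (x s).1) (ψ := fun x s => (x s).1) (by fun_prop) (by fun_prop)

variable [IsProbabilityMeasure Q]

/-- The cross products of the untreated outcomes of one individual with the residuals of another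
average out. Given the former, the sum is sub-Gaussian with a proxy of the order of the sum of
squared outcomes, which is of order `T0`. -/
theorem measureReal_sum_Y0_mul_u_le (hD : ConditionalDesign X Q T0 t mu0 p c m q) (hc : c ≠ 0)
    (hmu0 : Measurable (Function.uncurry mu0)) (hp : ∀ s, Measurable (p s)) {B : ℝ}
    (hm : ∀ i s, s ∈ insert t (Finset.Icc 1 T0) → |m i s| ≤ B) {k i : Fin N} (hki : k ≠ i) {x : ℝ}
    (hx : 0 ≤ x) :
    Q.real {ω | x * T0 < |∑ s ∈ Finset.Icc 1 T0, X.Y0 k s ω * X.u mu0 i s ω|} ≤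
      Real.exp (-T0) + 2 * Real.exp (-(x ^ 2 * T0 / (2 * c * (2 * B ^ 2 + 16 * c)))) := by
  have hc' : (0 : ℝ) < c := by positivity
  set V : ℝ := 2 * B ^ 2 + 16 * c with hV
  have hV0 : 0 < V := by positivity
  have hum : ∀ s : ↥(Finset.Icc 1 T0), s.1 ∈ insert t (Finset.Icc 1 T0) := fun s =>
    Finset.mem_insert_of_mem s.2
  let W : ↥(Finset.Icc 1 T0) → Ω → ℝ := fun s ω => m k s + X.u mu0 k s ω
  have h1 := measureReal_sum_sq_le hc
    (fun s : ↥(Finset.Icc 1 T0) => X.measurable_u hmu0 k s) (hD.iIndepFun_u k)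
    (fun s => hD.subgaussian_u k s (hum s))
  have h2 := measureReal_random_weighted_sum_le (W := W) (c := c)
    (y := x * √T0 / √V)
    (fun s => measurable_const.add (X.measurable_u hmu0 k s))
    (fun s : ↥(Finset.Icc 1 T0) => X.measurable_u hmu0 i s) (hD.iIndepFun_u i)
    (fun s => hD.subgaussian_u i s (hum s))
    ((hD.indepFun_u hmu0 hp hki).comp
      (φ := fun (x : ↥(Finset.Icc 1 T0) → ℝ) (s : ↥(Finset.Icc 1 T0)) => m k s + x s)
      (ψ := id) (by fun_prop) measurable_id)
    (by positivity)
  have hexp : -(x * √T0 / √V) ^ 2 / (2 * (c : ℝ)) = -(x ^ 2 * T0 / (2 * c * V)) := by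
    rw [div_pow, mul_pow, Real.sq_sqrt (by positivity), Real.sq_sqrt hV0.le]
    field_simp
  rw [hexp] at h2
  have hcard : Fintype.card ↥(Finset.Icc 1 T0) = T0 := by simp
  rw [hcard] at h1
  have hae : ∀ᵐ ω ∂Q, ∀ s : ↥(Finset.Icc 1 T0), X.Y0 k s ω = W s ω := by
    rw [ae_all_iff]
    intro s
    filter_upwards [hD.mean_outcome k s (hum s)] with ω hω
    simp only [W, Panel.u, hω]; ring
  refine le_trans ?_ ((measureReal_union_le _ _).trans (add_le_add h1 h2))
  refine ENNReal.toReal_mono (measure_ne_top _ _) (measure_mono_ae ?_)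
  filter_upwards [hae] with ω hω hlt
  have hlt : x * T0 < |∑ s ∈ Finset.Icc 1 T0, X.Y0 k s ω * X.u mu0 i s ω| := hlt
  by_cases hsq : 8 * c * T0 < ∑ s : ↥(Finset.Icc 1 T0), X.u mu0 k s ω ^ 2
  · exact Or.inl hsq
  refine Or.inr ?_
  show x * √T0 / √V * √(∑ s, W s ω ^ 2) < |∑ s : ↥(Finset.Icc 1 T0), W s ω * X.u mu0 i s ω|
  have hsum : ∑ s ∈ Finset.Icc 1 T0, X.Y0 k s ω * X.u mu0 i s ω =
      ∑ s : ↥(Finset.Icc 1 T0), W s ω * X.u mu0 i s ω := by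
    rw [← Finset.sum_coe_sort]
    exact Finset.sum_congr rfl fun s _ => by rw [hω s]
  rw [hsum] at hlt
  refine lt_of_le_of_lt ?_ hlt
  have hWV : ∑ s, W s ω ^ 2 ≤ V * T0 := by
    calc ∑ s, W s ω ^ 2 ≤ ∑ s : ↥(Finset.Icc 1 T0), (2 * B ^ 2 + 2 * X.u mu0 k s ω ^ 2) := by
          refine Finset.sum_le_sum fun s _ => ?_
          have := sq_le_sq' (abs_le.1 (hm k s (hum s))).1 (abs_le.1 (hm k s (hum s))).2
          simp only [W]
          nlinarith [sq_nonneg (m k s - X.u mu0 k s ω)]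
      _ = T0 * (2 * B ^ 2) + 2 * ∑ s : ↥(Finset.Icc 1 T0), X.u mu0 k s ω ^ 2 := by
          rw [Finset.sum_add_distrib, Finset.mul_sum]; simp
      _ ≤ V * T0 := by rw [hV]; nlinarith
  calc x * √T0 / √V * √(∑ s, W s ω ^ 2) ≤ x * √T0 / √V * √(V * T0) := by gcongr
    _ = x * T0 := by
        rw [Real.sqrt_mul hV0.le]
        have := (Real.sqrt_pos.2 hV0).ne'
        field_simp
        rw [Real.sq_sqrt (by positivity)]

theorem measureReal_sum_mean_mul_u_le (hD : ConditionalDesign X Q T0 t mu0 p c m q) {B : ℝ}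
    (hB : 0 < B) (hm : ∀ i s, s ∈ insert t (Finset.Icc 1 T0) → |m i s| ≤ B) (k i : Fin N) {x : ℝ}
    (hx : 0 ≤ x) :
    Q.real {ω | x * T0 <
      |∑ s ∈ Finset.Icc 1 T0, mu0 (X.α i ω) (X.lam s ω) * X.u mu0 k s ω|} ≤
      2 * Real.exp (-(x ^ 2 * T0 / (2 * c * B ^ 2))) := by
  have hum : ∀ s : ↥(Finset.Icc 1 T0), s.1 ∈ insert t (Finset.Icc 1 T0) := fun s =>
    Finset.mem_insert_of_mem s.2
  have h2 := measureReal_weighted_sum_le (c := c) (y := x * √T0 / B) (hD.iIndepFun_u k)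
    (fun s => hD.subgaussian_u k s (hum s)) (fun s => m i s) (by positivity)
  have hexp : -(x * √T0 / B) ^ 2 / (2 * (c : ℝ)) = -(x ^ 2 * T0 / (2 * c * B ^ 2)) := by
    rw [div_pow, mul_pow, Real.sq_sqrt (by positivity)]
    by_cases hc : (c : ℝ) = 0
    · simp [hc]
    · field_simp
  rw [hexp] at h2
  have hae : ∀ᵐ ω ∂Q, ∀ s : ↥(Finset.Icc 1 T0), mu0 (X.α i ω) (X.lam s ω) = m i s := by
    rw [ae_all_iff]
    exact fun s => hD.mean_outcome i s (hum s)
  refine le_trans (ENNReal.toReal_mono (measure_ne_top _ _) (measure_mono_ae ?_)) h2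
  filter_upwards [hae] with ω hω hlt
  have hlt : x * T0 < |∑ s ∈ Finset.Icc 1 T0, mu0 (X.α i ω) (X.lam s ω) * X.u mu0 k s ω| := hlt
  have hsum : ∑ s ∈ Finset.Icc 1 T0, mu0 (X.α i ω) (X.lam s ω) * X.u mu0 k s ω =
      ∑ s : ↥(Finset.Icc 1 T0), m i s * X.u mu0 k s ω := by
    rw [← Finset.sum_coe_sort]
    exact Finset.sum_congr rfl fun s _ => by rw [hω s]
  rw [hsum] at hlt
  refine lt_of_le_of_lt ?_ hlt
  have hWV : ∑ s : ↥(Finset.Icc 1 T0), m i s ^ 2 ≤ B ^ 2 * T0 := by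
    calc ∑ s : ↥(Finset.Icc 1 T0), m i s ^ 2 ≤ ∑ s : ↥(Finset.Icc 1 T0), B ^ 2 :=
          Finset.sum_le_sum fun s _ =>
            sq_le_sq' (abs_le.1 (hm i s (hum s))).1 (abs_le.1 (hm i s (hum s))).2
      _ = B ^ 2 * T0 := by simp [mul_comm]
  calc x * √T0 / B * √(∑ s : ↥(Finset.Icc 1 T0), m i s ^ 2)
      ≤ x * √T0 / B * √(B ^ 2 * T0) := by gcongr
    _ = x * T0 := by
        rw [Real.sqrt_mul (by positivity), Real.sqrt_sq hB.le]
        field_simp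
        rw [Real.sq_sqrt (by positivity)]

/-- Weights that depend on the pre-treatment residuals only are independent of the residuals of
period `t`. -/
theorem measureReal_preweighted_sum_le (hD : ConditionalDesign X Q T0 t mu0 p c m q) (ht : T0 < t)
    (hmu0 : Measurable (Function.uncurry mu0)) (hp : ∀ s, Measurable (p s))
    {F : (Fin N → ↥(Finset.Icc 1 T0) → ℝ) → Fin N → ℝ} (hF : Measurable F)
    {ζ : Fin N → ℝ × ℝ → ℝ} (hζ : ∀ j, Measurable (ζ j))
    (hsub : ∀ j, HasSubgaussianMGF (fun ω => ζ j (X.u mu0 j t ω, X.eps p j t ω)) c Q) {y : ℝ}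
    (hy : 0 ≤ y) :
    Q.real {ω | y * √(∑ j, F (fun k s => X.u mu0 k s ω) j ^ 2) <
      |∑ j, F (fun k s => X.u mu0 k s ω) j * ζ j (X.u mu0 j t ω, X.eps p j t ω)|} ≤
        2 * Real.exp (-y ^ 2 / (2 * c)) := by
  have hne : ∀ s : ↥(Finset.Icc 1 T0), s.1 ≠ t := fun s hs => by
    have := Finset.mem_Icc.1 s.2
    omega
  have hpre : IndepFun
      (fun ω (r : Fin N × ↥(Finset.Icc 1 T0)) => (X.u mu0 r.1 r.2 ω, X.eps p r.1 r.2 ω))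
      (fun ω (j : Fin N) => (X.u mu0 j t ω, X.eps p j t ω)) Q :=
    hD.indep.indepFun_precomp
      (fun r => (X.measurable_u hmu0 r.1 r.2).prodMk (X.measurable_eps hp r.1 r.2))
      (fun r : Fin N × ↥(Finset.Icc 1 T0) => (r.1, ⟨r.2, Finset.mem_insert_of_mem r.2.2⟩))
      (fun j : Fin N => (j, ⟨t, Finset.mem_insert_self _ _⟩))
      fun a b hab => hne a.2 (congrArg (fun r => r.2.1) hab)
  have hφ : Measurable fun (x : Fin N × ↥(Finset.Icc 1 T0) → ℝ × ℝ) => F fun k s => (x (k, s)).1 :=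
    hF.comp (measurable_pi_lambda _ fun k => measurable_pi_lambda _ fun s =>
      measurable_fst.comp (measurable_pi_apply (k, s)))
  have hψ : Measurable fun (x : Fin N → ℝ × ℝ) j => ζ j (x j) :=
    measurable_pi_lambda _ fun j => (hζ j).comp (measurable_pi_apply j)
  have hind : IndepFun (fun ω j => F (fun k s => X.u mu0 k s ω) j)
      (fun ω j => ζ j (X.u mu0 j t ω, X.eps p j t ω)) Q := hpre.comp hφ hψ
  have hinj : Function.Injective (fun j : Fin N =>
      ((j, ⟨t, Finset.mem_insert_self _ _⟩) : Fin N × ↥(insert t (Finset.Icc 1 T0)))) := by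
    intro a b hab
    exact congrArg Prod.fst hab
  have hξ : iIndepFun (fun j ω => ζ j (X.u mu0 j t ω, X.eps p j t ω)) Q :=
    (hD.indep.precomp hinj).comp ζ hζ
  exact measureReal_random_weighted_sum_le (c := c) (y := y)
    (W := fun j ω => F (fun k s => X.u mu0 k s ω) j)
    (ξ := fun j ω => ζ j (X.u mu0 j t ω, X.eps p j t ω))
    (fun j => ((measurable_pi_apply j).comp hF).comp (measurable_pi_lambda _ fun k =>
      measurable_pi_lambda _ fun s => X.measurable_u hmu0 k s))
    (fun j => (hζ j).comp ((X.measurable_u hmu0 j t).prodMk (X.measurable_eps hp j t)))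
    hξ hsub hind hy

/-- The kernel weights are functions of the pre-treatment residuals: the conditional means being
constant, the residuals determine the pre-treatment outcomes. -/
theorem measureReal_kernel_sum_le (hD : ConditionalDesign X Q T0 t mu0 p c m q) (ht : T0 < t)
    (hmu0 : Measurable (Function.uncurry mu0)) (hp : ∀ s, Measurable (p s)) {K : ℝ → ℝ}
    (hK : Measurable K) (h : ℝ) (i : Fin N) {ζ : Fin N → ℝ × ℝ → ℝ} (hζ : ∀ j, Measurable (ζ j))
    (hsub : ∀ j, HasSubgaussianMGF (fun ω => ζ j (X.u mu0 j t ω, X.eps p j t ω)) c Q) {y : ℝ}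
    (hy : 0 ≤ y) :
    Q.real {ω | y * √(∑ j, K (pseudoDist T0 (fun k s => X.Y0 k s ω) i j / h) ^ 2) <
      |∑ j, K (pseudoDist T0 (fun k s => X.Y0 k s ω) i j / h) *
        ζ j (X.u mu0 j t ω, X.eps p j t ω)|} ≤ 2 * Real.exp (-y ^ 2 / (2 * c)) := by
  let G : (Fin N → ↥(Finset.Icc 1 T0) → ℝ) → Fin N → ℕ → ℝ := fun v k s =>
    if hs : s ∈ Finset.Icc 1 T0 then m k s + v k ⟨s, hs⟩ else 0
  have hG : Measurable G := by
    refine measurable_pi_lambda _ fun k => measurable_pi_lambda _ fun s => ?_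
    by_cases hs : s ∈ Finset.Icc 1 T0
    · simp only [G, dif_pos hs]
      fun_prop
    · simp only [G, dif_neg hs]
      fun_prop
  have hF : Measurable fun v j => K (pseudoDist T0 (G v) i j / h) := measurable_pi_lambda _ fun j =>
    hK.comp (((measurable_pseudoDist T0 i j).comp hG).div_const h)
  have hb := hD.measureReal_preweighted_sum_le ht hmu0 hp hF hζ hsub hy
  refine le_trans (ENNReal.toReal_mono (measure_ne_top _ _) (measure_mono_ae ?_)) hb
  have hae : ∀ᵐ ω ∂Q, ∀ (k : Fin N) (s : ↥(Finset.Icc 1 T0)),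
      mu0 (X.α k ω) (X.lam s ω) = m k s := by
    rw [ae_all_iff]; intro k
    rw [ae_all_iff]; intro s
    exact hD.mean_outcome k s (Finset.mem_insert_of_mem s.2)
  filter_upwards [hae] with ω hω hlt
  have hFW : ∀ j, pseudoDist T0 (G fun k s => X.u mu0 k s ω) i j =
      pseudoDist T0 (fun k s => X.Y0 k s ω) i j := fun j => by
    refine pseudoDist_congr (fun k s hs => ?_) i j
    simp only [G]
    rw [dif_pos hs, Panel.u, hω k ⟨s, hs⟩]
    ring
  show y * √(∑ j, K (pseudoDist T0 (G fun k s => X.u mu0 k s ω) i j / h) ^ 2) <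
    |∑ j, K (pseudoDist T0 (G fun k s => X.u mu0 k s ω) i j / h) *
      ζ j (X.u mu0 j t ω, X.eps p j t ω)|
  simp only [hFW]
  exact hlt

theorem measureReal_kernel_sum_eps_le (hD : ConditionalDesign X Q T0 t mu0 p c m q) (ht : T0 < t)
    (hmu0 : Measurable (Function.uncurry mu0)) (hp : ∀ s, Measurable (p s)) {K : ℝ → ℝ}
    (hK : Measurable K) (h : ℝ) (i : Fin N) {y : ℝ} (hy : 0 ≤ y) :
    Q.real {ω | y * √(∑ j, K (pseudoDist T0 (fun k s => X.Y0 k s ω) i j / h) ^ 2) <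
      |∑ j, K (pseudoDist T0 (fun k s => X.Y0 k s ω) i j / h) * X.eps p j t ω|} ≤
        2 * Real.exp (-y ^ 2 / (2 * c)) :=
  hD.measureReal_kernel_sum_le ht hmu0 hp hK h i (ζ := fun _ => Prod.snd)
    (fun _ => measurable_snd) (fun j => hD.subgaussian_eps j) hy

/-- The residuals of the untreated: `(1 - w) u` is again sub-Gaussian since treatment and
untreated outcome are conditionally independent. -/
theorem measureReal_kernel_sum_u_le (hD : ConditionalDesign X Q T0 t mu0 p c m q) (ht : T0 < t)
    (hmu0 : Measurable (Function.uncurry mu0)) (hp : ∀ s, Measurable (p s)) {K : ℝ → ℝ}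
    (hK : Measurable K) (h : ℝ) (i : Fin N) {y : ℝ} (hy : 0 ≤ y) :
    Q.real {ω | y * √(∑ j, K (pseudoDist T0 (fun k s => X.Y0 k s ω) i j / h) ^ 2) <
      |∑ j, K (pseudoDist T0 (fun k s => X.Y0 k s ω) i j / h) *
        ((1 - X.w j t ω) * X.u mu0 j t ω)|} ≤ 2 * Real.exp (-y ^ 2 / (2 * c)) := by
  have htm : t ∈ insert t (Finset.Icc 1 T0) := Finset.mem_insert_self _ _
  have hae : ∀ j, (fun ω => (1 - X.w j t ω) * X.u mu0 j t ω) =ᵐ[Q]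
      fun ω => (1 - X.eps p j t ω - q j) * X.u mu0 j t ω := fun j => by
    filter_upwards [hD.mean_treatment j] with ω hω
    rw [Panel.eps, hω]; ring
  have hsub : ∀ j, HasSubgaussianMGF (fun ω => (1 - X.w j t ω) * X.u mu0 j t ω) c Q := fun j => by
    refine hasSubgaussianMGF_indicator_mul (measurable_const.sub (X.measurable_w j t))
      (X.measurable_u hmu0 j t) ?_ (hD.subgaussian_u j t htm) ?_
    · filter_upwards [hD.binary j] with ω hω
      rcases hω with h0 | h0 <;> simp [h0]
    · have h1 : IndepFun (fun ω => 1 - X.w j t ω) (fun ω => X.Y0 j t ω - m j t) Q :=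
        (hD.unconfounded j).symm.comp (φ := fun x => 1 - x) (ψ := fun x => x - m j t)
          (by fun_prop) (by fun_prop)
      refine h1.congr (ae_eq_refl _) ?_
      filter_upwards [hD.mean_outcome j t htm] with ω hω
      simp only [Panel.u, hω]
  have hb := hD.measureReal_kernel_sum_le ht hmu0 hp hK h i
    (ζ := fun j x => (1 - x.2 - q j) * x.1) (fun j => by fun_prop)
    (fun j => (hsub j).congr (hae j)) hy
  refine le_trans (ENNReal.toReal_mono (measure_ne_top _ _) (measure_mono_ae ?_)) hb
  filter_upwards [ae_all_iff.2 hae] with ω hω hlt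
  show _ < |∑ j, K (pseudoDist T0 (fun k s => X.Y0 k s ω) i j / h) *
    ((1 - X.eps p j t ω - q j) * X.u mu0 j t ω)|
  simp only [← hω]
  exact hlt

end ConditionalDesign

end

/-! ### Deviation bounds for the panel -/

/-- The second-moment kernel `∫ μ⁽⁰⁾(a, λ) μ⁽⁰⁾(b, λ) dπ(λ)`, the limit of the normalized inner
product of two outcome paths. -/
noncomputable def crossMoment {d : ℕ} {L : Type*} [MeasurableSpace L] (mu0 : Vec d → L → ℝ)
    (π : Measure L) (a b : Vec d) : ℝ :=
  ∫ l, mu0 a l * mu0 b l ∂π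

section

variable {Ω : Type*} [mΩ : MeasurableSpace Ω] {d : ℕ} {L : Type*} [MeasurableSpace L] {N : ℕ}
  {X : Panel Ω d L N} {mu0 : Vec d → L → ℝ} {p : ℕ → Vec d → ℝ} {P : Measure Ω}
  {T0 T t : ℕ} {A : Set (Vec d)} {ν : Measure (Vec d)} {π : Measure L}

theorem measurable_crossMoment [IsProbabilityMeasure π]
    (hmu0 : Measurable (Function.uncurry mu0)) :
    Measurable fun x : Vec d × Vec d => crossMoment mu0 π x.1 x.2 := by
  have h : StronglyMeasurable fun z : (Vec d × Vec d) × L => mu0 z.1.1 z.2 * mu0 z.1.2 z.2 := by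
    refine Measurable.stronglyMeasurable (Measurable.mul ?_ ?_)
    · exact hmu0.comp (by fun_prop : Measurable fun z : (Vec d × Vec d) × L => (z.1.1, z.2))
    · exact hmu0.comp (by fun_prop : Measurable fun z : (Vec d × Vec d) × L => (z.1.2, z.2))
  exact h.integral_prod_right'.measurable

theorem ae_mem_support (hs : X.FactorSampling P T ν π) :
    ∀ᵐ ω ∂P, ∀ i, X.α i ω ∈ ν.support := by
  rw [ae_all_iff]
  intro i
  refine ae_of_ae_map (X.measurable_α i).aemeasurable ?_
  rw [hs.law_α i]
  exact Measure.support_mem_ae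

/-- Averaging over the i.i.d. period factors, with the individual factors frozen. -/
theorem measureReal_sum_mean_mul_mean_le [IsProbabilityMeasure P] [IsProbabilityMeasure π]
    (hT : T0 ≤ T) (hmu0 : Measurable (Function.uncurry mu0)) (hs : X.FactorSampling P T ν π)
    (hA : ν.support ⊆ A) {B : ℝ} (hB : 0 < B) (hbd : ∀ a ∈ A, ∀ l, |mu0 a l| ≤ B) (k i : Fin N)
    {x : ℝ} (hx : 0 ≤ x) :
    P.real {ω | x * T0 < |(∑ s ∈ Finset.Icc 1 T0,
      mu0 (X.α k ω) (X.lam s ω) * mu0 (X.α i ω) (X.lam s ω)) -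
        T0 * crossMoment mu0 π (X.α k ω) (X.α i ω)|} ≤
      2 * Real.exp (-(x ^ 2 * T0 / (2 * B ^ 4))) := by
  have hmem : ∀ s : ↥(Finset.Icc 1 T0), s.1 ∈ Finset.Icc 1 T := fun s => by
    have := Finset.mem_Icc.1 s.2
    exact Finset.mem_Icc.2 (by omega)
  have hind : IndepFun (fun ω => (X.α k ω, X.α i ω))
      (fun ω (s : ↥(Finset.Icc 1 T0)) => X.lam s ω) P :=
    hs.indep.comp (φ := fun x => (x k, x i))
      (ψ := fun (l : ↥(Finset.Icc 1 T) → L) (s : ↥(Finset.Icc 1 T0)) => l ⟨s, hmem s⟩)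
      (by fun_prop) (by fun_prop)
  have hmu : ∀ a, Measurable (mu0 a) := fun a => hmu0.comp measurable_prodMk_left
  have hsum : ∀ ω, (∑ s ∈ Finset.Icc 1 T0,
      mu0 (X.α k ω) (X.lam s ω) * mu0 (X.α i ω) (X.lam s ω)) =
      ∑ s : ↥(Finset.Icc 1 T0), mu0 (X.α k ω) (X.lam s ω) * mu0 (X.α i ω) (X.lam s ω) :=
    fun ω => (Finset.sum_coe_sort (Finset.Icc 1 T0) fun s =>
      mu0 (X.α k ω) (X.lam s ω) * mu0 (X.α i ω) (X.lam s ω)).symm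
  simp only [hsum]
  refine measureReal_le_of_indepFun (X := fun ω => (X.α k ω, X.α i ω))
    (Y := fun ω (s : ↥(Finset.Icc 1 T0)) => X.lam s ω)
    (S := {z : (Vec d × Vec d) × (↥(Finset.Icc 1 T0) → L) | x * T0 <
      |(∑ s, mu0 z.1.1 (z.2 s) * mu0 z.1.2 (z.2 s)) - T0 * crossMoment mu0 π z.1.1 z.1.2|})
    ((X.measurable_α k).prodMk (X.measurable_α i))
    (measurable_pi_lambda _ fun s => X.measurable_lam s) hind ?_ (by positivity) ?_
  · refine measurableSet_lt measurable_const (Measurable.abs (Measurable.sub ?_ ?_))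
    · refine Finset.measurable_sum _ fun s _ => Measurable.mul ?_ ?_
      · exact hmu0.comp (by fun_prop :
          Measurable fun z : (Vec d × Vec d) × (↥(Finset.Icc 1 T0) → L) => (z.1.1, z.2 s))
      · exact hmu0.comp (by fun_prop :
          Measurable fun z : (Vec d × Vec d) × (↥(Finset.Icc 1 T0) → L) => (z.1.2, z.2 s))
    · exact ((measurable_crossMoment hmu0).comp measurable_fst).const_mul _
  filter_upwards [ae_mem_support hs] with ω hω
  set a := X.α k ω
  set b := X.α i ω
  have ha : a ∈ A := hA (hω k)
  have hb : b ∈ A := hA (hω i)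
  let f : L → ℝ := fun l => mu0 a l * mu0 b l
  have hf : Measurable f := (hmu a).mul (hmu b)
  have hfB : ∀ l, f l ∈ Set.Icc (-B ^ 2) (B ^ 2) := fun l => by
    have : |f l| ≤ B ^ 2 := by
      rw [abs_mul, sq]
      exact mul_le_mul (hbd a ha l) (hbd b hb l) (abs_nonneg _) hB.le
    exact ⟨by linarith [(abs_le.1 this).1], (abs_le.1 this).2⟩
  have hE : ∀ s : ↥(Finset.Icc 1 T0), ∫ ω, f (X.lam s ω) ∂P = crossMoment mu0 π a b := fun s => by
    rw [crossMoment, ← hs.law_lam s (hmem s),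
      integral_map (X.measurable_lam s).aemeasurable hf.aestronglyMeasurable]
  have hinj : Function.Injective fun s : ↥(Finset.Icc 1 T0) =>
      (⟨s, hmem s⟩ : ↥(Finset.Icc 1 T)) := by
    intro s s' h
    exact Subtype.ext (congrArg (fun z : ↥(Finset.Icc 1 T) => z.1) h)
  have hiI : iIndepFun (fun (s : ↥(Finset.Icc 1 T0)) ω => f (X.lam s ω) - crossMoment mu0 π a b)
      P :=
    (hs.indep_lam.precomp hinj).comp (fun _ l => f l - crossMoment mu0 π a b)
      fun _ => hf.sub_const _
  have hsub : ∀ s : ↥(Finset.Icc 1 T0), HasSubgaussianMGF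
      (fun ω => f (X.lam s ω) - crossMoment mu0 π a b) ((‖B ^ 2 - -B ^ 2‖₊ / 2) ^ 2) P := fun s => by
    rw [← hE s]
    exact hasSubgaussianMGF_of_mem_Icc (hf.comp (X.measurable_lam s)).aemeasurable
      (ae_of_all _ fun ω => hfB _)
  have hmain := measureReal_weighted_sum_le hiI hsub (fun _ => 1) (y := x * √T0) (by positivity)
  have hexp : -(x * √T0) ^ 2 / (2 * (((‖B ^ 2 - -B ^ 2‖₊ / 2) ^ 2 : ℝ≥0) : ℝ)) =
      -(x ^ 2 * T0 / (2 * B ^ 4)) := by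
    have h1 : (((‖B ^ 2 - -B ^ 2‖₊ / 2) ^ 2 : ℝ≥0) : ℝ) = B ^ 4 := by
      push_cast
      rw [Real.norm_eq_abs, abs_of_nonneg (by nlinarith [sq_nonneg B])]
      ring
    rw [h1, mul_pow, Real.sq_sqrt (by positivity), neg_div]
  rw [hexp] at hmain
  refine le_trans (le_of_eq ?_) hmain
  congr 1
  ext ω'
  have h1 : x * √T0 * √(∑ _s : ↥(Finset.Icc 1 T0), (1 : ℝ) ^ 2) = x * T0 := by
    simp [mul_assoc]
  have h2 : ∑ s : ↥(Finset.Icc 1 T0), 1 * (f (X.lam s ω') - crossMoment mu0 π a b) =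
      (∑ s : ↥(Finset.Icc 1 T0), mu0 a (X.lam s ω') * mu0 b (X.lam s ω')) -
        T0 * crossMoment mu0 π a b := by
    simp [f, Finset.sum_sub_distrib]
  show x * T0 < |_| ↔ x * √T0 * √(∑ _s : ↥(Finset.Icc 1 T0), (1 : ℝ) ^ 2) < |_|
  rw [h1, h2]

/-- The inner products of the untreated outcome paths of two different individuals are close to
their limits. -/
theorem measureReal_cross_le [StandardBorelSpace Ω] [IsProbabilityMeasure P]
    [IsProbabilityMeasure π] (ht : T0 < t ∧ t ≤ T) (hmu0 : Measurable (Function.uncurry mu0))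
    (hp : ∀ s, Measurable (p s)) (hs : X.FactorSampling P T ν π) {c : ℝ≥0} (hc : c ≠ 0)
    (hD : ∀ᵐ ω ∂P, ConditionalDesign X (condExpKernel P (X.latent T) ω) T0 t mu0 p c
      (fun i s => mu0 (X.α i ω) (X.lam s ω)) (fun i => p t (X.α i ω)))
    (hA : ν.support ⊆ A) {B : ℝ} (hB : 0 < B) (hbd : ∀ a ∈ A, ∀ l, |mu0 a l| ≤ B) {k i : Fin N}
    (hki : k ≠ i) {x : ℝ} (hx : 0 ≤ x) :
    P.real {ω | 3 * x * T0 < |(∑ s ∈ Finset.Icc 1 T0, X.Y0 k s ω * X.Y0 i s ω) -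
        T0 * crossMoment mu0 π (X.α k ω) (X.α i ω)|} ≤
      Real.exp (-T0) +
        6 * Real.exp (-(x ^ 2 * T0 / (2 * c * (2 * B ^ 2 + 16 * c) + 2 * B ^ 4))) := by
  have hc' : (0 : ℝ) < c := by positivity
  have hT0 : (0 : ℝ) ≤ x ^ 2 * T0 := by positivity
  have hsup := ae_mem_support hs
  have hm : ∀ᵐ ω ∂P, ∀ i s, s ∈ insert t (Finset.Icc 1 T0) →
      |mu0 (X.α i ω) (X.lam s ω)| ≤ B := by
    filter_upwards [hsup] with ω hω i s _ using hbd _ (hA (hω i)) _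
  have h1 := measureReal_sum_mean_mul_mean_le (by omega : T0 ≤ T) hmu0 hs hA hB hbd k i hx
  have h2 : P.real {ω | x * T0 <
      |∑ s ∈ Finset.Icc 1 T0, mu0 (X.α i ω) (X.lam s ω) * X.u mu0 k s ω|} ≤
      2 * Real.exp (-(x ^ 2 * T0 / (2 * c * B ^ 2))) := by
    refine measureReal_le_of_condExpKernel (X.latent_le T) ?_ (by positivity) ?_
    · exact measurableSet_lt measurable_const (Finset.measurable_sum _ fun s _ =>
        (X.measurable_mean hmu0 i s).mul (X.measurable_u hmu0 k s)).abs
    · filter_upwards [hD, hm] with ω hω hmω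
      exact hω.measureReal_sum_mean_mul_u_le hB hmω k i hx
  have h3 : P.real {ω | x * T0 < |∑ s ∈ Finset.Icc 1 T0, X.Y0 k s ω * X.u mu0 i s ω|} ≤
      Real.exp (-T0) + 2 * Real.exp (-(x ^ 2 * T0 / (2 * c * (2 * B ^ 2 + 16 * c)))) := by
    refine measureReal_le_of_condExpKernel (X.latent_le T) ?_ (by positivity) ?_
    · exact measurableSet_lt measurable_const (Finset.measurable_sum _ fun s _ =>
        (X.measurable_Y0 k s).mul (X.measurable_u hmu0 i s)).abs
    · filter_upwards [hD, hm] with ω hω hmω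
      exact hω.measureReal_sum_Y0_mul_u_le hc hmu0 hp hmω hki hx
  have hmono : ∀ V W : ℝ, 0 < V → V ≤ W →
      Real.exp (-(x ^ 2 * T0 / V)) ≤ Real.exp (-(x ^ 2 * T0 / W)) := fun V W hV hVW =>
    Real.exp_le_exp.2 (neg_le_neg (div_le_div_of_nonneg_left hT0 hV hVW))
  have e1 := hmono (2 * B ^ 4) (2 * c * (2 * B ^ 2 + 16 * c) + 2 * B ^ 4) (by positivity)
    (by nlinarith [mul_pos hc' hc', mul_pos hc' (pow_pos hB 2)])
  have e2 := hmono (2 * c * B ^ 2) (2 * c * (2 * B ^ 2 + 16 * c) + 2 * B ^ 4) (by positivity)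
    (by nlinarith [mul_pos hc' hc', mul_pos hc' (pow_pos hB 2), pow_pos hB 4])
  have e3 := hmono (2 * c * (2 * B ^ 2 + 16 * c)) (2 * c * (2 * B ^ 2 + 16 * c) + 2 * B ^ 4)
    (by positivity) (by nlinarith [pow_pos hB 4])
  calc _ ≤ P.real (({ω | x * T0 < |(∑ s ∈ Finset.Icc 1 T0,
          mu0 (X.α k ω) (X.lam s ω) * mu0 (X.α i ω) (X.lam s ω)) -
            T0 * crossMoment mu0 π (X.α k ω) (X.α i ω)|} ∪
        {ω | x * T0 < |∑ s ∈ Finset.Icc 1 T0, mu0 (X.α i ω) (X.lam s ω) * X.u mu0 k s ω|}) ∪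
        {ω | x * T0 < |∑ s ∈ Finset.Icc 1 T0, X.Y0 k s ω * X.u mu0 i s ω|}) := by
        refine measureReal_mono fun ω hω => ?_
        have hω : 3 * x * T0 < |(∑ s ∈ Finset.Icc 1 T0, X.Y0 k s ω * X.Y0 i s ω) -
          T0 * crossMoment mu0 π (X.α k ω) (X.α i ω)| := hω
        by_contra hcon
        simp only [Set.mem_union, Set.mem_ofPred_eq, not_or, not_lt] at hcon
        obtain ⟨⟨b1, b2⟩, b3⟩ := hcon
        have hdec : (∑ s ∈ Finset.Icc 1 T0, X.Y0 k s ω * X.Y0 i s ω) =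
            (∑ s ∈ Finset.Icc 1 T0, mu0 (X.α k ω) (X.lam s ω) * mu0 (X.α i ω) (X.lam s ω)) +
            (∑ s ∈ Finset.Icc 1 T0, mu0 (X.α i ω) (X.lam s ω) * X.u mu0 k s ω) +
            ∑ s ∈ Finset.Icc 1 T0, X.Y0 k s ω * X.u mu0 i s ω := by
          rw [← Finset.sum_add_distrib, ← Finset.sum_add_distrib]
          refine Finset.sum_congr rfl fun s _ => ?_
          simp only [Panel.u]; ring
        rw [hdec] at hω
        rw [abs_le] at b1 b2 b3
        rcases lt_abs.1 hω with h | h <;> linarith [b1.1, b1.2, b2.1, b2.2, b3.1, b3.2]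
    _ ≤ _ := (measureReal_union_le _ _).trans (add_le_add (measureReal_union_le _ _) le_rfl)
    _ ≤ _ := by linarith

theorem measureReal_kernel_eps_le [StandardBorelSpace Ω] [IsProbabilityMeasure P]
    (ht : T0 < t) (hmu0 : Measurable (Function.uncurry mu0)) (hp : ∀ s, Measurable (p s))
    {c : ℝ≥0}
    (hD : ∀ᵐ ω ∂P, ConditionalDesign X (condExpKernel P (X.latent T) ω) T0 t mu0 p c
      (fun i s => mu0 (X.α i ω) (X.lam s ω)) (fun i => p t (X.α i ω)))
    {K : ℝ → ℝ} (hK : Measurable K) (h : ℝ) (i : Fin N) {y : ℝ} (hy : 0 ≤ y) :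
    P.real {ω | y * √(∑ j, K (pseudoDist T0 (fun k s => X.Y0 k s ω) i j / h) ^ 2) <
      |∑ j, K (pseudoDist T0 (fun k s => X.Y0 k s ω) i j / h) * X.eps p j t ω|} ≤
        2 * Real.exp (-y ^ 2 / (2 * c)) := by
  have hKm : ∀ j, Measurable fun ω => K (pseudoDist T0 (fun k s => X.Y0 k s ω) i j / h) :=
    fun j => hK.comp (((measurable_pseudoDist T0 i j).comp (measurable_pi_lambda _ fun k =>
      measurable_pi_lambda _ fun s => X.measurable_Y0 k s)).div_const h)
  have hem := fun j => X.measurable_eps hp j t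
  refine measureReal_le_of_condExpKernel (X.latent_le T) ?_ (by positivity) ?_
  · exact measurableSet_lt
      ((Finset.measurable_sum _ fun j _ => (hKm j).pow_const 2).sqrt.const_mul y)
      (Finset.measurable_sum _ fun j _ => (hKm j).mul (hem j)).abs
  · filter_upwards [hD] with ω hω
    exact hω.measureReal_kernel_sum_eps_le ht hmu0 hp hK h i hy

theorem measureReal_kernel_u_le [StandardBorelSpace Ω] [IsProbabilityMeasure P]
    (ht : T0 < t) (hmu0 : Measurable (Function.uncurry mu0)) (hp : ∀ s, Measurable (p s))
    {c : ℝ≥0}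
    (hD : ∀ᵐ ω ∂P, ConditionalDesign X (condExpKernel P (X.latent T) ω) T0 t mu0 p c
      (fun i s => mu0 (X.α i ω) (X.lam s ω)) (fun i => p t (X.α i ω)))
    {K : ℝ → ℝ} (hK : Measurable K) (h : ℝ) (i : Fin N) {y : ℝ} (hy : 0 ≤ y) :
    P.real {ω | y * √(∑ j, K (pseudoDist T0 (fun k s => X.Y0 k s ω) i j / h) ^ 2) <
      |∑ j, K (pseudoDist T0 (fun k s => X.Y0 k s ω) i j / h) *
        ((1 - X.w j t ω) * X.u mu0 j t ω)|} ≤ 2 * Real.exp (-y ^ 2 / (2 * c)) := by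
  have hKm : ∀ j, Measurable fun ω => K (pseudoDist T0 (fun k s => X.Y0 k s ω) i j / h) :=
    fun j => hK.comp (((measurable_pseudoDist T0 i j).comp (measurable_pi_lambda _ fun k =>
      measurable_pi_lambda _ fun s => X.measurable_Y0 k s)).div_const h)
  have hum := fun j => X.measurable_u hmu0 j t
  have hwm := fun j => X.measurable_w j t
  refine measureReal_le_of_condExpKernel (X.latent_le T) ?_ (by positivity) ?_
  · exact measurableSet_lt
      ((Finset.measurable_sum _ fun j _ => (hKm j).pow_const 2).sqrt.const_mul y)
      (Finset.measurable_sum _ fun j _ =>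
        (hKm j).mul ((measurable_const.sub (hwm j)).mul (hum j))).abs
  · filter_upwards [hD] with ω hω
    exact hω.measureReal_kernel_sum_u_le ht hmu0 hp hK h i hy

/-- Every individual has many others in a ball around its own factor. -/
theorem measureReal_neighbours_le [IsProbabilityMeasure P] (hs : X.FactorSampling P T ν π)
    {r q : ℝ} (hq : ∀ a ∈ ν.support, q ≤ ν.real (Metric.closedBall a r))
    (i : Fin N) :
    P.real {ω | ∑ j ∈ Finset.univ.erase i,
        (Metric.closedBall (X.α i ω) r).indicator (fun _ => (1 : ℝ)) (X.α j ω) ≤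
          ((N : ℝ) - 1) * q / 4} ≤ Real.exp (-(((N : ℝ) - 1) * q / 4)) := by
  have hind : IndepFun (X.α i) (fun ω (j : ↥(Finset.univ.erase i)) => X.α j ω) P :=
    (hs.indep_α.indepFun_precomp X.measurable_α (fun _ : Unit => i)
      (fun j : ↥(Finset.univ.erase i) => j.1)
      (fun _ j hj => (Finset.mem_erase.1 j.2).1 hj.symm)).comp
      (φ := fun x : Unit → Vec d => x ()) (ψ := id) (measurable_pi_apply ()) measurable_id
  have hcard : ((Finset.univ : Finset ↥(Finset.univ.erase i)).card : ℝ) = (N : ℝ) - 1 := by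
    have hN : 1 ≤ N := Nat.one_le_iff_ne_zero.2 fun h => by subst h; exact i.elim0
    simp [Finset.card_erase_of_mem, Nat.cast_sub hN]
  have hsum : ∀ ω, ∑ j ∈ Finset.univ.erase i,
      (Metric.closedBall (X.α i ω) r).indicator (fun _ => (1 : ℝ)) (X.α j ω) =
      ∑ j : ↥(Finset.univ.erase i),
        (Metric.closedBall (X.α i ω) r).indicator (fun _ => (1 : ℝ)) (X.α j ω) := fun ω =>
    (Finset.sum_coe_sort (Finset.univ.erase i) fun j =>
      (Metric.closedBall (X.α i ω) r).indicator (fun _ => (1 : ℝ)) (X.α j ω)).symm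
  simp only [hsum]
  refine measureReal_le_of_indepFun (X := X.α i)
    (Y := fun ω (j : ↥(Finset.univ.erase i)) => X.α j ω)
    (S := {z : Vec d × (↥(Finset.univ.erase i) → Vec d) | ∑ j,
      (Metric.closedBall z.1 r).indicator (fun _ => (1 : ℝ)) (z.2 j) ≤ ((N : ℝ) - 1) * q / 4})
    (X.measurable_α i) (measurable_pi_lambda _ fun j => X.measurable_α j) hind ?_ (by positivity) ?_
  · refine measurableSet_le (Finset.measurable_sum _ fun j _ => ?_) measurable_const
    have : (fun z : Vec d × (↥(Finset.univ.erase i) → Vec d) =>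
        (Metric.closedBall z.1 r).indicator (fun _ => (1 : ℝ)) (z.2 j)) =
        {z : Vec d × (↥(Finset.univ.erase i) → Vec d) | dist (z.2 j) z.1 ≤ r}.indicator
          fun _ => 1 := by
      ext z
      simp [Set.indicator]
    rw [this]
    exact measurable_const.indicator (measurableSet_le (by fun_prop) measurable_const)
  · filter_upwards [ae_mem_support hs] with ω hω
    have := measureReal_count_le (Q := P) (X := fun (j : ↥(Finset.univ.erase i)) => X.α j)
      (fun j => X.measurable_α j) (hs.indep_α.precomp Subtype.val_injective)
      (fun j => hs.law_α j) (B := Metric.closedBall (X.α i ω) r) measurableSet_closedBall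
      Finset.univ (hq _ (hω i))
    rw [hcard] at this
    exact this

end

/-! ### The pseudo-distance and the distance of the factors -/

theorem pseudoDist_nonneg {N : ℕ} (T0 : ℕ) (y : Fin N → ℕ → ℝ) (i j : Fin N) :
    0 ≤ pseudoDist T0 y i j :=
  mul_nonneg (by positivity) (Real.iSup_nonneg fun _ => abs_nonneg _)

section PseudoDist

variable {N T0 : ℕ} {y : Fin N → ℕ → ℝ} {g : Fin N → Fin N → ℝ} {x : ℝ}

theorem abs_sum_mul_sub_le (hT0 : 0 < T0)
    (hG : ∀ k i, k ≠ i → |(∑ s ∈ Finset.Icc 1 T0, y k s * y i s) - T0 * g k i| ≤ x * T0)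
    {i j k : Fin N} (hi : k ≠ i) (hj : k ≠ j) :
    |(1 / (T0 : ℝ)) * |∑ s ∈ Finset.Icc 1 T0, y k s * (y i s - y j s)| - (|g k i - g k j|)| ≤
      2 * x := by
  have hT : (0 : ℝ) < T0 := by exact_mod_cast hT0
  have h1 := hG k i hi
  have h2 := hG k j hj
  have hsum : ∑ s ∈ Finset.Icc 1 T0, y k s * (y i s - y j s) =
      (∑ s ∈ Finset.Icc 1 T0, y k s * y i s) - ∑ s ∈ Finset.Icc 1 T0, y k s * y j s := by
    rw [← Finset.sum_sub_distrib]
    exact Finset.sum_congr rfl fun s _ => mul_sub _ _ _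
  have h3 : (1 / (T0 : ℝ)) * |∑ s ∈ Finset.Icc 1 T0, y k s * (y i s - y j s)| =
      |(∑ s ∈ Finset.Icc 1 T0, y k s * (y i s - y j s)) / T0| := by
    rw [abs_div, abs_of_pos hT]; ring
  rw [h3]
  refine (abs_abs_sub_abs_le_abs_sub _ _).trans ?_
  rw [show (∑ s ∈ Finset.Icc 1 T0, y k s * (y i s - y j s)) / (T0 : ℝ) - (g k i - g k j) =
      (((∑ s ∈ Finset.Icc 1 T0, y k s * y i s) - T0 * g k i) -
        ((∑ s ∈ Finset.Icc 1 T0, y k s * y j s) - T0 * g k j)) / T0 by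
    rw [hsum]; field_simp; ring]
  rw [abs_div, abs_of_pos hT, div_le_iff₀ hT]
  exact (abs_sub _ _).trans (by linarith)

theorem pseudoDist_le (hT0 : 0 < T0)
    (hG : ∀ k i, k ≠ i → |(∑ s ∈ Finset.Icc 1 T0, y k s * y i s) - T0 * g k i| ≤ x * T0)
    (hx : 0 ≤ x) {i j : Fin N} {z : ℝ} (hz : 0 ≤ z)
    (h : ∀ k, k ≠ i → k ≠ j → |g k i - g k j| ≤ z) : pseudoDist T0 y i j ≤ z + 2 * x := by
  unfold pseudoDist
  rw [Real.mul_iSup_of_nonneg (by positivity)]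
  refine Real.iSup_le (fun k => ?_) (by positivity)
  have h1 := abs_le.1 (abs_sum_mul_sub_le hT0 hG k.2.1 k.2.2)
  linarith [h k k.2.1 k.2.2, h1.2]

theorem le_pseudoDist (hT0 : 0 < T0)
    (hG : ∀ k i, k ≠ i → |(∑ s ∈ Finset.Icc 1 T0, y k s * y i s) - T0 * g k i| ≤ x * T0)
    {i j k : Fin N} (hi : k ≠ i) (hj : k ≠ j) :
    |g k i - g k j| ≤ pseudoDist T0 y i j + 2 * x := by
  have h1 := abs_le.1 (abs_sum_mul_sub_le hT0 hG hi hj)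
  have h2 : (1 / (T0 : ℝ)) * |∑ s ∈ Finset.Icc 1 T0, y k s * (y i s - y j s)| ≤
      pseudoDist T0 y i j := by
    unfold pseudoDist
    refine mul_le_mul_of_nonneg_left ?_ (by positivity)
    exact le_ciSup (f := fun k : {k : Fin N // k ≠ i ∧ k ≠ j} =>
      |∑ s ∈ Finset.Icc 1 T0, y k s * (y i s - y j s)|) (Set.finite_range _).bddAbove ⟨k, hi, hj⟩
  linarith [h1.1]

end PseudoDist

section CrossMoment

variable {d : ℕ} {L : Type*} [MeasurableSpace L] {A : Set (Vec d)} {ν : Measure (Vec d)}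
  {π : Measure L} [IsProbabilityMeasure π] {mu0 : Vec d → L → ℝ}

theorem integrable_of_abs_le {f : L → ℝ} (hf : Measurable f) {B : ℝ} (hB : ∀ l, |f l| ≤ B) :
    Integrable f π :=
  Integrable.of_mem_Icc (-B) B hf.aemeasurable (ae_of_all _ fun l => abs_le.1 (hB l))

theorem integral_abs_le_sqrt {f : L → ℝ} (hf : Measurable f) {B : ℝ} (hB : ∀ l, |f l| ≤ B) :
    (∫ l, |f l| ∂π) ≤ √(∫ l, f l ^ 2 ∂π) := by
  refine Real.le_sqrt_of_sq_le ?_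
  have hint : MemLp (fun l => |f l|) 2 π :=
    MemLp.of_bound hf.abs.aestronglyMeasurable B (ae_of_all _ fun l => by simpa using hB l)
  have h := variance_nonneg (fun l => |f l|) π
  rw [variance_eq_sub hint] at h
  simp only [Pi.pow_apply, sq_abs] at h
  linarith

theorem crossMoment_sub_crossMoment (hmu : ∀ a, Measurable (mu0 a)) {B : ℝ}
    (hbd : ∀ a ∈ A, ∀ l, |mu0 a l| ≤ B) {a b e : Vec d} (ha : a ∈ A) (hb : b ∈ A) (he : e ∈ A) :
    crossMoment mu0 π e a - crossMoment mu0 π e b = ∫ l, mu0 e l * (mu0 a l - mu0 b l) ∂π := by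
  have hint : ∀ a ∈ A, Integrable (fun l => mu0 e l * mu0 a l) π := fun a ha =>
    integrable_of_abs_le ((hmu e).mul (hmu a)) (B := B * B) fun l => by
      rw [abs_mul]
      exact mul_le_mul (hbd e he l) (hbd a ha l) (abs_nonneg _)
        ((abs_nonneg _).trans (hbd e he l))
  rw [crossMoment, crossMoment, ← integral_sub (hint a ha) (hint b hb)]
  exact integral_congr_ae (ae_of_all _ fun l => by ring)

theorem abs_crossMoment_sub_le (hmu : ∀ a, Measurable (mu0 a)) {B L0 : ℝ}
    (hbd : ∀ a ∈ A, ∀ l, |mu0 a l| ≤ B)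
    (hlip : ∀ a ∈ A, ∀ b ∈ A, ∀ l, |mu0 a l - mu0 b l| ≤ L0 * ‖a - b‖) {a b e : Vec d}
    (ha : a ∈ A) (hb : b ∈ A) (he : e ∈ A) :
    |crossMoment mu0 π e a - crossMoment mu0 π e b| ≤ B * (L0 * ‖a - b‖) := by
  rw [crossMoment_sub_crossMoment hmu hbd ha hb he]
  have h := norm_integral_le_of_norm_le_const (μ := π) (C := B * (L0 * ‖a - b‖))
    (f := fun l => mu0 e l * (mu0 a l - mu0 b l)) (ae_of_all _ fun l => by
      rw [Real.norm_eq_abs, abs_mul]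
      exact mul_le_mul (hbd e he l) (hlip a ha b hb l) (abs_nonneg _)
        ((abs_nonneg _).trans (hbd e he l)))
  simpa using h

/-- Two factors are separated by the cross moments with all factors `e'` close enough to a
suitable `e` in the support. Replacing `e` by `e'` costs at most
`L0 ‖e' - e‖ ∫ |μ⁽⁰⁾(a, ·) - μ⁽⁰⁾(b, ·)|`, a small multiple of the separation at `e`, so the
required closeness does not depend on `a` and `b`. -/
theorem exists_crossMoment_separation (hmu : ∀ a, Measurable (mu0 a)) (hA : ν.support ⊆ A)
    {B L0 c₁ c₂ : ℝ} (hbd : ∀ a ∈ A, ∀ l, |mu0 a l| ≤ B)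
    (hlip : ∀ a ∈ A, ∀ b ∈ A, ∀ l, |mu0 a l - mu0 b l| ≤ L0 * ‖a - b‖)
    (hc₁ : 0 < c₁) (hc₂ : 0 < c₂)
    (hdist : ∀ a ∈ A, ∀ b ∈ A, c₁ * ‖a - b‖ ^ 2 ≤ ∫ l, (mu0 a l - mu0 b l) ^ 2 ∂π ∧
      c₂ * √(∫ l, (mu0 a l - mu0 b l) ^ 2 ∂π) ≤
        ⨆ e : ν.support, ∫ l, mu0 e l * (mu0 a l - mu0 b l) ∂π)
    {a b : Vec d} (ha : a ∈ ν.support) (hb : b ∈ ν.support) :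
    ∃ e ∈ ν.support, ∀ e' ∈ A, L0 * ‖e' - e‖ ≤ c₂ / 4 →
      c₂ / 4 * √c₁ * ‖a - b‖ ≤ |crossMoment mu0 π e' a - crossMoment mu0 π e' b| := by
  obtain ⟨h1, h2⟩ := hdist a (hA ha) b (hA hb)
  set D := ∫ l, (mu0 a l - mu0 b l) ^ 2 ∂π with hD
  have hD0 : 0 ≤ D := integral_nonneg fun l => sq_nonneg _
  have hsq : √c₁ * ‖a - b‖ ≤ √D := by
    refine Real.le_sqrt_of_sq_le ?_
    rw [mul_pow, Real.sq_sqrt hc₁.le]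
    exact h1
  rcases hD0.eq_or_lt with h0 | h0
  · refine ⟨a, ha, fun e' _ _ => ?_⟩
    have hz : √D = 0 := by rw [← h0]; simp
    rw [hz] at hsq
    calc c₂ / 4 * √c₁ * ‖a - b‖ = c₂ / 4 * (√c₁ * ‖a - b‖) := by ring
      _ ≤ 0 := mul_nonpos_of_nonneg_of_nonpos (by positivity) hsq
      _ ≤ _ := abs_nonneg _
  have hsD : 0 < √D := Real.sqrt_pos.2 h0
  have : Nonempty ν.support := ⟨⟨a, ha⟩⟩
  obtain ⟨e, he⟩ := exists_lt_of_lt_ciSup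
    (lt_of_lt_of_le (by nlinarith : c₂ / 2 * √D < c₂ * √D) h2)
  refine ⟨e, e.2, fun e' he' hee => ?_⟩
  have heA := hA e.2
  have hfm : Measurable fun l => mu0 a l - mu0 b l := (hmu a).sub (hmu b)
  have hfB : ∀ l, |mu0 a l - mu0 b l| ≤ 2 * B := fun l =>
    (abs_sub _ _).trans (by linarith [hbd a (hA ha) l, hbd b (hA hb) l])
  have hint : ∀ e ∈ A, Integrable (fun l => mu0 e l * (mu0 a l - mu0 b l)) π := fun e he =>
    integrable_of_abs_le ((hmu e).mul hfm) (B := B * (2 * B)) fun l => by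
      rw [abs_mul]
      exact mul_le_mul (hbd e he l) (hfB l) (abs_nonneg _) ((abs_nonneg _).trans (hbd e he l))
  have hdiff : (∫ l, mu0 e l * (mu0 a l - mu0 b l) ∂π) -
      ∫ l, mu0 e' l * (mu0 a l - mu0 b l) ∂π ≤ c₂ / 4 * √D := by
    rw [← integral_sub (hint e heA) (hint e' he')]
    calc _ ≤ ∫ l, c₂ / 4 * |mu0 a l - mu0 b l| ∂π := by
          refine integral_mono ((hint e heA).sub (hint e' he'))
            ((integrable_of_abs_le hfm hfB).abs.const_mul _) fun l => ?_
          show mu0 e l * (mu0 a l - mu0 b l) - mu0 e' l * (mu0 a l - mu0 b l) ≤ _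
          rw [← sub_mul]
          refine (le_abs_self _).trans ?_
          rw [abs_mul]
          refine mul_le_mul_of_nonneg_right ?_ (abs_nonneg _)
          have := hlip e' he' e heA l
          rw [abs_sub_comm]
          exact this.trans hee
      _ = c₂ / 4 * ∫ l, |mu0 a l - mu0 b l| ∂π := integral_const_mul _ _
      _ ≤ _ := mul_le_mul_of_nonneg_left (integral_abs_le_sqrt hfm hfB) (by positivity)
  rw [crossMoment_sub_crossMoment hmu hbd (hA ha) (hA hb) he']
  refine le_trans ?_ (le_abs_self _)
  calc c₂ / 4 * √c₁ * ‖a - b‖ = c₂ / 4 * (√c₁ * ‖a - b‖) := by ring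
    _ ≤ c₂ / 4 * √D := mul_le_mul_of_nonneg_left hsq (by positivity)
    _ ≤ _ := by linarith

end CrossMoment

/-! ### Kernel averages -/

/-- Error of a weighted average of `m j + e j` as an estimate of `m₀`: the bias over the indices
that carry weight plus the weighted noise. -/
theorem abs_weighted_average_sub_le {ι : Type*} [Fintype ι] {κ m e : ι → ℝ} {m₀ b R : ℝ}
    (hκ : ∀ j, 0 ≤ κ j) (hS : 0 < ∑ j, κ j) (hb : ∀ j, κ j ≠ 0 → |m j - m₀| ≤ b)
    (hR : |∑ j, κ j * e j| ≤ R) :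
    |(∑ j, κ j * (m j + e j)) / (∑ j, κ j) - m₀| ≤ b + R / ∑ j, κ j := by
  have h1 : (∑ j, κ j * (m j + e j)) / (∑ j, κ j) - m₀ =
      ((∑ j, κ j * (m j - m₀)) + ∑ j, κ j * e j) / ∑ j, κ j := by
    rw [div_sub' hS.ne', Finset.sum_mul, ← Finset.sum_sub_distrib, ← Finset.sum_add_distrib]
    congr 1
    exact Finset.sum_congr rfl fun j _ => by ring
  rw [h1, abs_div, abs_of_pos hS, div_le_iff₀ hS, add_mul, div_mul_cancel₀ _ hS.ne']
  refine (abs_add_le _ _).trans (add_le_add ?_ hR)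
  refine (Finset.abs_sum_le_sum_abs _ _).trans ?_
  rw [Finset.mul_sum]
  refine Finset.sum_le_sum fun j _ => ?_
  rw [abs_mul, abs_of_nonneg (hκ j), mul_comm]
  by_cases h0 : κ j = 0
  · simp [h0]
  · exact mul_le_mul_of_nonneg_right (hb j h0) (hκ j)

/-- For weights in `[0, B]` with sum at least `S₀`, noise of the order of the Euclidean norm of the
weights becomes small relative to the sum of the weights. -/
theorem noise_le_of_weights {ι : Type*} [Fintype ι] {κ : ι → ℝ} {B S₀ y : ℝ} (hy : 0 ≤ y)
    (hκ : ∀ j, 0 ≤ κ j) (hκB : ∀ j, κ j ≤ B) (hB : 0 ≤ B) (hS₀ : 0 < S₀) (hS : S₀ ≤ ∑ j, κ j) :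
    y * √(∑ j, κ j ^ 2) ≤ y * √B / √S₀ * ∑ j, κ j := by
  have hSpos : 0 < ∑ j, κ j := hS₀.trans_le hS
  have h1 : ∑ j, κ j ^ 2 ≤ B * ∑ j, κ j := by
    rw [Finset.mul_sum]
    exact Finset.sum_le_sum fun j _ => by nlinarith [hκ j, hκB j]
  have h2 : √(∑ j, κ j) * √S₀ ≤ ∑ j, κ j := by
    calc √(∑ j, κ j) * √S₀ ≤ √(∑ j, κ j) * √(∑ j, κ j) := by gcongr
      _ = _ := Real.mul_self_sqrt hSpos.le
  have h3 : 0 < √S₀ := Real.sqrt_pos.2 hS₀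
  calc y * √(∑ j, κ j ^ 2) ≤ y * √(B * ∑ j, κ j) := by gcongr
    _ = y * √B * √(∑ j, κ j) := by rw [Real.sqrt_mul hB]; ring
    _ ≤ y * √B * ((∑ j, κ j) / √S₀) := by
        gcongr
        rwa [le_div_iff₀ h3]
    _ = _ := by ring

/-! ### Typical samples -/

section

variable {Ω : Type*} [mΩ : MeasurableSpace Ω] {d : ℕ} {L : Type*} [MeasurableSpace L] {N : ℕ}

/-- A realization of the panel in which all stochastic fluctuations are under control: the inner
products of the pre-treatment paths are within `x` of their limits, the kernel-weighted residuals
of period `t` are at most `y` times the Euclidean norm of the weights, every individual has `n₀`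
neighbours within distance `r`, and more than two individuals lie within `ρ` of each point of
`net`. The remaining fields hold almost surely. -/
structure TypicalSample (X : Panel Ω d L N) (mu0 : Vec d → L → ℝ) (p : ℕ → Vec d → ℝ) (K : ℝ → ℝ)
    (ν : Measure (Vec d)) (π : Measure L) (h : ℝ) (T0 t : ℕ) (κ : ℝ) (net : Finset (Vec d))
    (ρ x y r n₀ : ℝ) (ω : Ω) : Prop where
  mem_support : ∀ i, X.α i ω ∈ ν.support
  binary : ∀ i, X.w i t ω = 0 ∨ X.w i t ω = 1
  untreated : ∀ i, X.w i t ω = 0 → X.Y i t ω = X.Y0 i t ω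
  pretreatment : ∀ i, ∀ s ∈ Finset.Icc 1 T0, X.Y i s ω = X.Y0 i s ω
  overlap : ∀ i, κ ≤ 1 - p t (X.α i ω)
  cross : ∀ k i, k ≠ i → |(∑ s ∈ Finset.Icc 1 T0, X.Y0 k s ω * X.Y0 i s ω) -
    T0 * crossMoment mu0 π (X.α k ω) (X.α i ω)| ≤ x * T0
  noise_eps : ∀ i, |∑ j, K (pseudoDist T0 (fun k s => X.Y0 k s ω) i j / h) * X.eps p j t ω| ≤
    y * √(∑ j, K (pseudoDist T0 (fun k s => X.Y0 k s ω) i j / h) ^ 2)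
  noise_u : ∀ i, |∑ j, K (pseudoDist T0 (fun k s => X.Y0 k s ω) i j / h) *
      ((1 - X.w j t ω) * X.u mu0 j t ω)| ≤
    y * √(∑ j, K (pseudoDist T0 (fun k s => X.Y0 k s ω) i j / h) ^ 2)
  neighbours : ∀ i, n₀ ≤ ∑ j ∈ Finset.univ.erase i,
    (Metric.closedBall (X.α i ω) r).indicator (fun _ => (1 : ℝ)) (X.α j ω)
  net_visited : ∀ e ∈ net, 2 < ∑ j, (Metric.closedBall e ρ).indicator (fun _ => (1 : ℝ)) (X.α j ω)

variable {X : Panel Ω d L N} {mu0 : Vec d → L → ℝ} {p : ℕ → Vec d → ℝ} {K : ℝ → ℝ}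
  {A : Set (Vec d)} {ν : Measure (Vec d)} {π : Measure L} {h : ℝ} {T0 T t : ℕ} {κ : ℝ}
  {net : Finset (Vec d)} {ρ x y r n₀ : ℝ} {ω : Ω}

namespace TypicalSample

theorem pseudoDist_le [IsProbabilityMeasure π]
    (G : TypicalSample X mu0 p K ν π h T0 t κ net ρ x y r n₀ ω) (hT0 : 0 < T0) (hx : 0 ≤ x)
    (hmu : ∀ a, Measurable (mu0 a)) (hA : ν.support ⊆ A) {B L0 : ℝ} (hB : 0 ≤ B) (hL0 : 0 ≤ L0)
    (hbd : ∀ a ∈ A, ∀ l, |mu0 a l| ≤ B)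
    (hlip : ∀ a ∈ A, ∀ b ∈ A, ∀ l, |mu0 a l - mu0 b l| ≤ L0 * ‖a - b‖) (i j : Fin N) :
    pseudoDist T0 (fun k s => X.Y0 k s ω) i j ≤ B * (L0 * ‖X.α i ω - X.α j ω‖) + 2 * x :=
  LatentPanel.pseudoDist_le hT0
    (g := fun k i => crossMoment mu0 π (X.α k ω) (X.α i ω)) G.cross hx (by positivity)
    fun k _ _ => abs_crossMoment_sub_le hmu hbd hlip (hA (G.mem_support i))
      (hA (G.mem_support j)) (hA (G.mem_support k))

/-- The pseudo-distance dominates the distance of the factors: the point of the support that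
separates `α_i` and `α_j` is near a point of the net, hence near some `α_k` with `k ∉ {i, j}`. -/
theorem norm_sub_le_pseudoDist [IsProbabilityMeasure π]
    (G : TypicalSample X mu0 p K ν π h T0 t κ net ρ x y r n₀ ω) (hT0 : 0 < T0)
    (hmu : ∀ a, Measurable (mu0 a)) (hA : ν.support ⊆ A) {B L0 c₁ c₂ : ℝ} (hL0 : 0 ≤ L0)
    (hbd : ∀ a ∈ A, ∀ l, |mu0 a l| ≤ B)
    (hlip : ∀ a ∈ A, ∀ b ∈ A, ∀ l, |mu0 a l - mu0 b l| ≤ L0 * ‖a - b‖)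
    (hc₁ : 0 < c₁) (hc₂ : 0 < c₂)
    (hdist : ∀ a ∈ A, ∀ b ∈ A, c₁ * ‖a - b‖ ^ 2 ≤ ∫ l, (mu0 a l - mu0 b l) ^ 2 ∂π ∧
      c₂ * √(∫ l, (mu0 a l - mu0 b l) ^ 2 ∂π) ≤
        ⨆ e : ν.support, ∫ l, mu0 e l * (mu0 a l - mu0 b l) ∂π)
    (hnet : ν.support ⊆ ⋃ e ∈ net, Metric.closedBall e ρ) (hρ : L0 * (2 * ρ) ≤ c₂ / 4)
    (i j : Fin N) :
    c₂ / 4 * √c₁ * ‖X.α i ω - X.α j ω‖ ≤ pseudoDist T0 (fun k s => X.Y0 k s ω) i j + 2 * x := by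
  obtain ⟨e, he, hsep⟩ := exists_crossMoment_separation hmu hA hbd hlip hc₁ hc₂ hdist
    (G.mem_support i) (G.mem_support j)
  obtain ⟨e₀, he₀, hee₀⟩ := Set.mem_iUnion₂.1 (hnet he)
  have hk : ∃ k, k ≠ i ∧ k ≠ j ∧ X.α k ω ∈ Metric.closedBall e₀ ρ := by
    by_contra hcon
    push Not at hcon
    have h2 := G.net_visited e₀ he₀
    have hsub : ∑ k, (Metric.closedBall e₀ ρ).indicator (fun _ => (1 : ℝ)) (X.α k ω) =
        ∑ k ∈ {i, j}, (Metric.closedBall e₀ ρ).indicator (fun _ => (1 : ℝ)) (X.α k ω) := by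
      symm
      refine Finset.sum_subset (Finset.subset_univ _) fun k _ hk => ?_
      simp only [Finset.mem_insert, Finset.mem_singleton, not_or] at hk
      exact Set.indicator_of_notMem (hcon k hk.1 hk.2) _
    have hle : ∑ k ∈ {i, j}, (Metric.closedBall e₀ ρ).indicator (fun _ => (1 : ℝ)) (X.α k ω) ≤
        ∑ k ∈ ({i, j} : Finset (Fin N)), 1 :=
      Finset.sum_le_sum fun k _ => Set.indicator_le_self' (fun _ _ => zero_le_one) _
    have hcard : (({i, j} : Finset (Fin N)).card : ℝ) ≤ 2 := by exact_mod_cast Finset.card_le_two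
    rw [hsub] at h2
    simp only [Finset.sum_const, nsmul_eq_mul, mul_one] at hle
    linarith
  obtain ⟨k, hki, hkj, hkb⟩ := hk
  refine (hsep (X.α k ω) (hA (G.mem_support k)) ?_).trans
    (le_pseudoDist hT0 (g := fun k i => crossMoment mu0 π (X.α k ω) (X.α i ω)) G.cross hki hkj)
  refine le_trans (mul_le_mul_of_nonneg_left ?_ hL0) hρ
  rw [← dist_eq_norm]
  have h1 := dist_triangle_right (X.α k ω) e e₀
  rw [Metric.mem_closedBall] at hkb hee₀
  linarith

/-- The neighbours of an individual contribute `klow` each to its total kernel weight. -/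
theorem le_sum_kernel (G : TypicalSample X mu0 p K ν π h T0 t κ net ρ x y r n₀ ω)
    (hK : ∀ z, 0 ≤ z → 0 ≤ K z) {klow z₀ : ℝ} (hk0 : 0 ≤ klow)
    (hlow : ∀ z, 0 ≤ z → z ≤ z₀ → klow ≤ K z) (hh : 0 < h) {B : ℝ} (hB : 0 ≤ B)
    (hpd : ∀ i j, pseudoDist T0 (fun k s => X.Y0 k s ω) i j ≤ B * ‖X.α i ω - X.α j ω‖ + 2 * x)
    (hr : B * r + 2 * x ≤ z₀ * h) (i : Fin N) :
    klow * n₀ ≤ ∑ j, K (pseudoDist T0 (fun k s => X.Y0 k s ω) i j / h) := by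
  have hnn : ∀ j, 0 ≤ pseudoDist T0 (fun k s => X.Y0 k s ω) i j / h := fun j =>
    div_nonneg (pseudoDist_nonneg _ _ _ _) hh.le
  calc klow * n₀ ≤ klow * ∑ j ∈ Finset.univ.erase i,
        (Metric.closedBall (X.α i ω) r).indicator (fun _ => (1 : ℝ)) (X.α j ω) :=
        mul_le_mul_of_nonneg_left (G.neighbours i) hk0
    _ ≤ ∑ j ∈ Finset.univ.erase i, K (pseudoDist T0 (fun k s => X.Y0 k s ω) i j / h) := by
        rw [Finset.mul_sum]
        refine Finset.sum_le_sum fun j _ => ?_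
        by_cases hj : X.α j ω ∈ Metric.closedBall (X.α i ω) r
        · rw [Set.indicator_of_mem hj, mul_one]
          refine hlow _ (hnn j) ((div_le_iff₀ hh).2 ((hpd i j).trans (le_trans ?_ hr)))
          rw [Metric.mem_closedBall, dist_comm, dist_eq_norm] at hj
          gcongr
        · rw [Set.indicator_of_notMem hj, mul_zero]
          exact hK _ (hnn j)
    _ ≤ _ := Finset.sum_le_sum_of_subset_of_nonneg (Finset.erase_subset _ _)
        fun j _ _ => hK _ (hnn j)

theorem abs_pHat_sub_le (G : TypicalSample X mu0 p K ν π h T0 t κ net ρ x y r n₀ ω)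
    (hh : 0 < h) (hy : 0 ≤ y) (hK : ∀ z, 0 ≤ z → 0 ≤ K z) {BK : ℝ} (hBK : 0 ≤ BK)
    (hKB : ∀ z, 0 ≤ z → K z ≤ BK)
    (hA : ν.support ⊆ A) {Lp : ℝ} (hLp : 0 ≤ Lp)
    (hlip : ∀ a ∈ A, ∀ b ∈ A, |p t a - p t b| ≤ Lp * ‖a - b‖) {S₀ b : ℝ} (hS₀ : 0 < S₀)
    (hS : ∀ i, S₀ ≤ ∑ j, K (pseudoDist T0 (fun k s => X.Y0 k s ω) i j / h))
    (hb : ∀ i j, K (pseudoDist T0 (fun k s => X.Y0 k s ω) i j / h) ≠ 0 →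
      ‖X.α i ω - X.α j ω‖ ≤ b) (i : Fin N) :
    |pHat K h T0 t (fun j s => X.Y j s ω) (fun j s => X.w j s ω) i - p t (X.α i ω)| ≤
      Lp * b + y * √BK / √S₀ := by
  have hnn : ∀ j, 0 ≤ pseudoDist T0 (fun k s => X.Y0 k s ω) i j / h := fun j =>
    div_nonneg (pseudoDist_nonneg _ _ _ _) hh.le
  have hpd : ∀ j, pseudoDist T0 (fun k s => X.Y k s ω) i j =
      pseudoDist T0 (fun k s => X.Y0 k s ω) i j := fun j => pseudoDist_congr G.pretreatment i j
  unfold pHat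
  simp only [hpd]
  have hSi := hS i
  have hbi := hb i
  have hεi := G.noise_eps i
  have hk0 := fun j => hK _ (hnn j)
  have hkB := fun j => hKB _ (hnn j)
  obtain ⟨k, hk⟩ : ∃ k : Fin N → ℝ, ∀ j,
      K (pseudoDist T0 (fun k s => X.Y0 k s ω) i j / h) = k j := ⟨_, fun _ => rfl⟩
  simp only [hk] at hSi hbi hεi hk0 hkB ⊢
  have hpos := hS₀.trans_le hSi
  have hw : ∀ j, X.w j t ω = p t (X.α j ω) + X.eps p j t ω := fun j => by
    simp [Panel.eps]
  simp only [hw]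
  refine (abs_weighted_average_sub_le hk0 hpos (b := Lp * b) (fun j hj => ?_)
    (hεi.trans (noise_le_of_weights hy hk0 hkB hBK hS₀ hSi))).trans ?_
  · refine (hlip _ (hA (G.mem_support j)) _ (hA (G.mem_support i))).trans ?_
    rw [norm_sub_rev]
    exact mul_le_mul_of_nonneg_left (hbi j hj) hLp
  · rw [mul_div_cancel_right₀ _ hpos.ne']

theorem abs_muHat_sub_le (G : TypicalSample X mu0 p K ν π h T0 t κ net ρ x y r n₀ ω)
    (hh : 0 < h) (hy : 0 ≤ y) (hK : ∀ z, 0 ≤ z → 0 ≤ K z) {BK : ℝ} (hBK : 0 ≤ BK)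
    (hKB : ∀ z, 0 ≤ z → K z ≤ BK) (hκ : 0 < κ)
    (hA : ν.support ⊆ A) {L0 : ℝ} (hL0 : 0 ≤ L0)
    (hlip : ∀ a ∈ A, ∀ b ∈ A, ∀ l, |mu0 a l - mu0 b l| ≤ L0 * ‖a - b‖) {S₀ b : ℝ} (hS₀ : 0 < S₀)
    (hS : ∀ i, S₀ ≤ ∑ j, K (pseudoDist T0 (fun k s => X.Y0 k s ω) i j / h))
    (hb : ∀ i j, K (pseudoDist T0 (fun k s => X.Y0 k s ω) i j / h) ≠ 0 →
      ‖X.α i ω - X.α j ω‖ ≤ b) (hsmall : y * √BK / √S₀ ≤ κ / 2) (i : Fin N) :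
    |muHat K h T0 t (fun j s => X.Y j s ω) (fun j s => X.w j s ω) i -
      mu0 (X.α i ω) (X.lam t ω)| ≤ L0 * b + 2 / κ * (y * √BK / √S₀) := by
  have hnn : ∀ j, 0 ≤ pseudoDist T0 (fun k s => X.Y0 k s ω) i j / h := fun j =>
    div_nonneg (pseudoDist_nonneg _ _ _ _) hh.le
  have hpd : ∀ j, pseudoDist T0 (fun k s => X.Y k s ω) i j =
      pseudoDist T0 (fun k s => X.Y0 k s ω) i j := fun j => pseudoDist_congr G.pretreatment i j
  unfold muHat
  simp only [hpd]
  have hSi := hS i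
  have hbi := hb i
  have hεi := G.noise_eps i
  have hui := G.noise_u i
  have hk0 := fun j => hK _ (hnn j)
  have hkB := fun j => hKB _ (hnn j)
  obtain ⟨k, hk⟩ : ∃ k : Fin N → ℝ, ∀ j,
      K (pseudoDist T0 (fun k s => X.Y0 k s ω) i j / h) = k j := ⟨_, fun _ => rfl⟩
  simp only [hk] at hSi hbi hεi hui hk0 hkB ⊢
  have hpos := hS₀.trans_le hSi
  have hnoise := noise_le_of_weights hy hk0 hkB hBK hS₀ hSi
  set τ := y * √BK / √S₀ with hτ
  have hden : ∑ j ∈ Finset.univ.filter (fun j => X.w j t ω = 0), k j =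
      ∑ j, k j * (1 - X.w j t ω) := by
    rw [Finset.sum_filter]
    refine Finset.sum_congr rfl fun j _ => ?_
    rcases G.binary j with hw | hw <;> simp [hw]
  have hnum : ∑ j ∈ Finset.univ.filter (fun j => X.w j t ω = 0), k j * X.Y j t ω =
      ∑ j, k j * (1 - X.w j t ω) * (mu0 (X.α j ω) (X.lam t ω) + X.u mu0 j t ω) := by
    rw [Finset.sum_filter]
    refine Finset.sum_congr rfl fun j _ => ?_
    rcases G.binary j with hw | hw
    · simp [hw, G.untreated j hw, Panel.u]
    · simp [hw]
  rw [hnum, hden]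
  have hk0' : ∀ j, 0 ≤ k j * (1 - X.w j t ω) := fun j => by
    rcases G.binary j with hw | hw <;> simp [hw, hk0 j]
  -- Overlap leaves a fixed fraction of the kernel mass on untreated individuals.
  have hS' : κ / 2 * ∑ j, k j ≤ ∑ j, k j * (1 - X.w j t ω) := by
    have h1 : ∑ j, k j * (1 - X.w j t ω) =
        (∑ j, k j * (1 - p t (X.α j ω))) - ∑ j, k j * X.eps p j t ω := by
      rw [← Finset.sum_sub_distrib]
      exact Finset.sum_congr rfl fun j _ => by simp only [Panel.eps]; ring
    have h2 : κ * ∑ j, k j ≤ ∑ j, k j * (1 - p t (X.α j ω)) := by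
      rw [Finset.mul_sum]
      exact Finset.sum_le_sum fun j _ => by
        rw [mul_comm]; exact mul_le_mul_of_nonneg_left (G.overlap j) (hk0 j)
    have h3 := (abs_le.1 (hεi.trans hnoise)).2
    have h4 : τ * ∑ j, k j ≤ κ / 2 * ∑ j, k j := mul_le_mul_of_nonneg_right hsmall hpos.le
    rw [h1]
    linarith
  have hpos' : 0 < ∑ j, k j * (1 - X.w j t ω) := lt_of_lt_of_le (by positivity) hS'
  have hR : |∑ j, k j * (1 - X.w j t ω) * X.u mu0 j t ω| ≤ τ * ∑ j, k j := by
    simp only [mul_assoc]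
    exact hui.trans hnoise
  refine (abs_weighted_average_sub_le hk0' hpos' (b := L0 * b) (fun j hj => ?_) hR).trans ?_
  · refine (hlip _ (hA (G.mem_support j)) _ (hA (G.mem_support i)) _).trans ?_
    rw [norm_sub_rev]
    exact mul_le_mul_of_nonneg_left (hbi j (left_ne_zero_of_mul hj)) hL0
  · gcongr
    rw [div_le_iff₀ hpos']
    have hτ0 : 0 ≤ τ := by positivity
    calc τ * ∑ j, k j = 2 / κ * τ * (κ / 2 * ∑ j, k j) := by field_simp
      _ ≤ _ := mul_le_mul_of_nonneg_left hS' (by positivity)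

end TypicalSample

end

/-! ### Probability of a typical sample -/

/-- A kernel is only constrained on `[0, ∞)`; precomposing with the absolute value discards its
values elsewhere, which no pseudo-distance reaches. -/
theorem IsKernel.measurable_comp_abs {K : ℝ → ℝ} (hK : IsKernel K) :
    Measurable fun z => K |z| := by
  obtain ⟨B, hB⟩ := hK.lipschitz
  have : LipschitzWith (Real.toNNReal |B|) fun z => K |z| := by
    refine LipschitzWith.of_dist_le_mul fun z z' => ?_
    rw [Real.dist_eq, Real.dist_eq, Real.coe_toNNReal _ (abs_nonneg B)]
    refine (hB _ _ (abs_nonneg z) (abs_nonneg z')).trans ?_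
    exact mul_le_mul (le_abs_self B) (abs_abs_sub_abs_le_abs_sub z z') (abs_nonneg _) (abs_nonneg _)
  exact this.continuous.measurable

theorem exp_neg_mul_log_le {n : ℕ} (hn : 1 ≤ n) {k : ℕ} {z : ℝ} (hz : k * Real.log n ≤ z) :
    Real.exp (-z) ≤ 1 / (n : ℝ) ^ k := by
  have hn0 : (0 : ℝ) < n := by exact_mod_cast hn
  calc Real.exp (-z) ≤ Real.exp (-(k * Real.log n)) := Real.exp_le_exp.2 (neg_le_neg hz)
    _ = 1 / (n : ℝ) ^ k := by
        rw [Real.exp_neg, Real.exp_nat_mul, Real.exp_log hn0, one_div]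

/-- A sample is typical with high probability, provided that each of the deviation bounds is
strong enough to survive the union over pairs of individuals. -/
theorem measureReal_not_typicalSample_le {Ω : Type*} [MeasurableSpace Ω] [StandardBorelSpace Ω]
    {d : ℕ} {L : Type*} [MeasurableSpace L] {N : ℕ} {X : Panel Ω d L N} {P : Measure Ω}
    [IsProbabilityMeasure P] {mu0 : Vec d → L → ℝ} {p : ℕ → Vec d → ℝ} {K : ℝ → ℝ}
    {A : Set (Vec d)} {ν : Measure (Vec d)} {π : Measure L} [IsProbabilityMeasure π] {h : ℝ}
    {T0 T t : ℕ} {κ : ℝ} {δ : ℝ≥0} (hN : 1 ≤ N) (ht : T0 < t ∧ t ≤ T)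
    (hmu0 : Measurable (Function.uncurry mu0)) (hp : ∀ s, Measurable (p s))
    (hbin : X.BinaryTreatment P T0 T) (hant : X.NoAnticipation P T)
    (hunc : X.LatentUnconfounded P T) (hov : X.Overlap P T0 T p κ)
    (herr : X.ErrorConditions P T0 T t mu0 p δ) (hs : X.FactorSampling P T ν π)
    (hK : IsKernel K) (hh : 0 < h) (hA : ν.support ⊆ A) {B : ℝ} (hB : 0 < B)
    (hbd : ∀ a ∈ A, ∀ l, |mu0 a l| ≤ B) {x y r q qρ ρ : ℝ} {net : Finset (Vec d)}
    (hx : 0 ≤ x) (hy : 0 ≤ y)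
    (hq : ∀ a ∈ ν.support, q ≤ ν.real (Metric.closedBall a r))
    (hqρ : ∀ a ∈ net, qρ ≤ ν.real (Metric.closedBall a ρ))
    (hT0 : 3 * Real.log N ≤ T0)
    (hxT : 3 * Real.log N ≤ x ^ 2 * T0 /
      (2 * (2 * δ + 1) * (2 * B ^ 2 + 16 * (2 * δ + 1)) + 2 * B ^ 4))
    (hyN : 2 * Real.log N ≤ y ^ 2 / (2 * (2 * δ + 1)))
    (hqN : 2 * Real.log N ≤ ((N : ℝ) - 1) * q / 4) (hqρN : 2 ≤ N * qρ / 4) :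
    P.real {ω | ¬ TypicalSample X mu0 p K ν π h T0 t κ net ρ (3 * x) y r
      (((N : ℝ) - 1) * q / 4) ω} ≤ 12 / N + net.card * Real.exp (-(N * qρ / 4)) := by
  have hN0 : (0 : ℝ) < N := by exact_mod_cast hN
  have htI : t ∈ Finset.Icc 1 T := Finset.mem_Icc.2 (by omega)
  have hD := ae_conditionalDesign ht hmu0 hp hbin hunc herr
  have hc : (2 * δ + 1 : ℝ≥0) ≠ 0 := by positivity
  have hcoe : ((2 * δ + 1 : ℝ≥0) : ℝ) = 2 * δ + 1 := by push_cast; rfl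
  let pd : Ω → Fin N → Fin N → ℝ := fun ω i j => pseudoDist T0 (fun k s => X.Y0 k s ω) i j
  have hpd : ∀ ω i j, |pseudoDist T0 (fun k s => X.Y0 k s ω) i j / h| =
      pseudoDist T0 (fun k s => X.Y0 k s ω) i j / h := fun ω i j =>
    abs_of_nonneg (div_nonneg (pseudoDist_nonneg _ _ _ _) hh.le)
  let E₁ : Fin N → Fin N → Set Ω := fun k i => {ω | k ≠ i ∧ 3 * x * T0 <
    |(∑ s ∈ Finset.Icc 1 T0, X.Y0 k s ω * X.Y0 i s ω) -
      T0 * crossMoment mu0 π (X.α k ω) (X.α i ω)|}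
  let E₂ : Fin N → Set Ω := fun i => {ω | y * √(∑ j, K (pd ω i j / h) ^ 2) <
    |∑ j, K (pd ω i j / h) * X.eps p j t ω|}
  let E₃ : Fin N → Set Ω := fun i => {ω | y * √(∑ j, K (pd ω i j / h) ^ 2) <
    |∑ j, K (pd ω i j / h) * ((1 - X.w j t ω) * X.u mu0 j t ω)|}
  let E₄ : Fin N → Set Ω := fun i => {ω | ∑ j ∈ Finset.univ.erase i,
    (Metric.closedBall (X.α i ω) r).indicator (fun _ => (1 : ℝ)) (X.α j ω) ≤
      ((N : ℝ) - 1) * q / 4}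
  let E₅ : Vec d → Set Ω := fun e => {ω | ∑ j,
    (Metric.closedBall e ρ).indicator (fun _ => (1 : ℝ)) (X.α j ω) ≤ N * qρ / 4}
  have h1 : ∀ k i, P.real (E₁ k i) ≤ 7 / (N : ℝ) ^ 3 := fun k i => by
    by_cases hki : k = i
    · simp only [E₁, hki, ne_eq, not_true_eq_false, false_and]
      simp
      positivity
    · have := measureReal_cross_le ht hmu0 hp hs hc hD hA hB hbd hki hx
      rw [hcoe] at this
      refine (measureReal_mono fun ω hω => hω.2).trans (this.trans ?_)
      have e1 := exp_neg_mul_log_le hN (k := 3) (z := T0) ((le_of_eq (by norm_num)).trans hT0)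
      have e2 := exp_neg_mul_log_le hN (k := 3) ((le_of_eq (by norm_num)).trans hxT)
      calc _ ≤ 1 / (N : ℝ) ^ 3 + 6 * (1 / (N : ℝ) ^ 3) := by gcongr
        _ = _ := by ring
  have hyexp : 2 * Real.exp (-y ^ 2 / (2 * ((2 * δ + 1 : ℝ≥0) : ℝ))) ≤ 2 / (N : ℝ) ^ 2 := by
    have := exp_neg_mul_log_le hN (k := 2) ((le_of_eq (by norm_num)).trans hyN)
    rw [hcoe, neg_div]
    calc _ ≤ 2 * (1 / (N : ℝ) ^ 2) := by gcongr
      _ = _ := by ring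
  have h2 : ∀ i, P.real (E₂ i) ≤ 2 / (N : ℝ) ^ 2 := fun i => by
    have := measureReal_kernel_eps_le ht.1 hmu0 hp hD hK.measurable_comp_abs h i hy
    simp only [hpd] at this
    exact this.trans hyexp
  have h3 : ∀ i, P.real (E₃ i) ≤ 2 / (N : ℝ) ^ 2 := fun i => by
    have := measureReal_kernel_u_le ht.1 hmu0 hp hD hK.measurable_comp_abs h i hy
    simp only [hpd] at this
    exact this.trans hyexp
  have h4 : ∀ i, P.real (E₄ i) ≤ 1 / (N : ℝ) ^ 2 := fun i =>
    (measureReal_neighbours_le hs hq i).trans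
      (exp_neg_mul_log_le hN (k := 2) ((le_of_eq (by norm_num)).trans hqN))
  have h5 : ∀ e ∈ net, P.real (E₅ e) ≤ Real.exp (-(N * qρ / 4)) := fun e he => by
    have := measureReal_count_le X.measurable_α hs.indep_α hs.law_α
      (measurableSet_closedBall (x := e) (ε := ρ)) Finset.univ (hqρ e he)
    simpa using this
  let U : Set Ω := ((⋃ z : Fin N × Fin N, E₁ z.1 z.2) ∪
    ⋃ i, (E₂ i ∪ E₃ i) ∪ E₄ i) ∪ ⋃ e ∈ net, E₅ e
  have hcover : {ω | ¬ TypicalSample X mu0 p K ν π h T0 t κ net ρ (3 * x) y r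
      (((N : ℝ) - 1) * q / 4) ω} ≤ᵐ[P] U := by
    have a1 := ae_mem_support hs
    have a2 : ∀ᵐ ω ∂P, ∀ i, X.w i t ω = 0 ∨ X.w i t ω = 1 :=
      ae_all_iff.2 fun i => hbin.1 i t htI
    have a3 : ∀ᵐ ω ∂P, ∀ i, X.w i t ω = 0 → X.Y i t ω = X.Y0 i t ω :=
      ae_all_iff.2 fun i => hant i t htI
    have a4 : ∀ᵐ ω ∂P, ∀ i, ∀ s : ↥(Finset.Icc 1 T0), X.Y i s ω = X.Y0 i s ω := by
      refine ae_all_iff.2 fun i => ae_all_iff.2 fun s => ?_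
      have hsT : s.1 ∈ Finset.Icc 1 T := by
        have := Finset.mem_Icc.1 s.2
        exact Finset.mem_Icc.2 (by omega)
      filter_upwards [hbin.2 i s s.2, hant i s hsT] with ω hw hY using hY hw
    have a5 : ∀ᵐ ω ∂P, ∀ i, κ ≤ 1 - p t (X.α i ω) :=
      ae_all_iff.2 fun i => hov i t (Finset.mem_Ioc.2 ht)
    filter_upwards [a1, a2, a3, a4, a5] with ω b1 b2 b3 b4 b5 hω
    by_contra hcon
    refine hω ?_
    have hcon' : ω ∉ ((⋃ z : Fin N × Fin N, E₁ z.1 z.2) ∪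
        ⋃ i, (E₂ i ∪ E₃ i) ∪ E₄ i) ∪ ⋃ e ∈ net, E₅ e := hcon
    simp only [Set.mem_union, Set.mem_iUnion, not_or, not_exists] at hcon'
    obtain ⟨⟨n1, n2⟩, n3⟩ := hcon'
    refine ⟨b1, b2, b3, fun i s hs => b4 i ⟨s, hs⟩, b5, fun k i hki => ?_, fun i => ?_,
      fun i => ?_, fun i => ?_, fun e he => ?_⟩
    · exact not_lt.1 fun hlt => n1 (k, i) ⟨hki, hlt⟩
    · exact not_lt.1 fun hlt => (n2 i).1.1 hlt
    · exact not_lt.1 fun hlt => (n2 i).1.2 hlt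
    · exact (not_le.1 fun hle => (n2 i).2 hle).le
    · exact not_le.1 fun hle => n3 e he (hle.trans hqρN)
  calc _ ≤ P.real U :=
        ENNReal.toReal_mono (measure_ne_top _ _) (measure_mono_ae hcover)
    _ ≤ ((∑ z : Fin N × Fin N, P.real (E₁ z.1 z.2)) +
          ∑ i, ((P.real (E₂ i) + P.real (E₃ i)) + P.real (E₄ i))) +
          ∑ e ∈ net, P.real (E₅ e) := by
        refine (measureReal_union_le _ _).trans (add_le_add ?_ (measureReal_biUnion_finset_le _ _))
        refine (measureReal_union_le _ _).trans
          (add_le_add (measureReal_iUnion_fintype_le _) ?_)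
        refine (measureReal_iUnion_fintype_le _).trans (Finset.sum_le_sum fun i _ => ?_)
        exact (measureReal_union_le _ _).trans
          (add_le_add (measureReal_union_le _ _) le_rfl)
    _ ≤ ((∑ _z : Fin N × Fin N, 7 / (N : ℝ) ^ 3) +
          ∑ _i : Fin N, ((2 / (N : ℝ) ^ 2 + 2 / (N : ℝ) ^ 2) + 1 / (N : ℝ) ^ 2)) +
          ∑ _e ∈ net, Real.exp (-(N * qρ / 4)) := by
        refine add_le_add (add_le_add ?_ ?_) ?_
        · exact Finset.sum_le_sum fun z _ => h1 _ _
        · exact Finset.sum_le_sum fun i _ => add_le_add (add_le_add (h2 i) (h3 i)) (h4 i)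
        · exact Finset.sum_le_sum fun e he => h5 e he
    _ = 12 / N + net.card * Real.exp (-(N * qρ / 4)) := by
        simp only [Finset.sum_const, Finset.card_univ, Fintype.card_prod, Fintype.card_fin,
          nsmul_eq_mul]
        push_cast
        field_simp
        ring

/-! ### Rates -/

theorem eventually_mul_log_le_sq_mul {h : ℕ → ℝ} {T0 : ℕ → ℕ} (hh : ∀ N, 0 < h N)
    (hT0 : ∀ N, 0 < T0 N)
    (hrate : Tendsto (fun N : ℕ => 1 / h N * √(Real.log N / T0 N)) atTop (𝓝 0)) {M : ℝ}
    (hM : 0 < M) : ∀ᶠ N : ℕ in atTop, M * Real.log N ≤ h N ^ 2 * T0 N := by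
  filter_upwards [hrate.eventually_lt_const (Real.sqrt_pos.2 (one_div_pos.2 hM))] with N hN
  have hT : (0 : ℝ) < T0 N := by exact_mod_cast hT0 N
  rw [one_div_mul_eq_div, div_lt_iff₀ (hh N)] at hN
  have h1 := (Real.sqrt_le_iff.1 hN.le).2
  rw [mul_pow, Real.sq_sqrt (by positivity), div_le_iff₀ hT, one_div, mul_assoc,
    ← div_eq_inv_mul, le_div_iff₀ hM] at h1
  linarith

theorem eventually_mul_log_le_pow_mul {h : ℕ → ℝ} {d : ℕ} (hh : ∀ N, 0 < h N) {H : ℝ}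
    (hH : ∀ N, h N ≤ H)
    (hrate : Tendsto (fun N : ℕ => Real.log N / (h N ^ (2 * d) * N)) atTop (𝓝 0)) {M : ℝ}
    (hM : 0 < M) : ∀ᶠ N : ℕ in atTop, M * Real.log N ≤ h N ^ d * N := by
  have hH0 : 0 < H := (hh 0).trans_le (hH 0)
  filter_upwards [hrate.eventually_lt_const (by positivity : 0 < 1 / (M * H ^ d)),
    eventually_ge_atTop 1] with N hN hN1
  have hN0 : (0 : ℝ) < N := by exact_mod_cast hN1
  have hhN := hh N
  rw [div_lt_div_iff₀ (by positivity) (by positivity), one_mul] at hN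
  have h1 : h N ^ (2 * d) * N ≤ h N ^ d * N * H ^ d := by
    rw [two_mul, pow_add]
    have : h N ^ d ≤ H ^ d := pow_le_pow_left₀ hhN.le (hH N) d
    calc h N ^ d * h N ^ d * N = h N ^ d * N * h N ^ d := by ring
      _ ≤ _ := by gcongr
  have h2 : (M * Real.log N) * H ^ d ≤ (h N ^ d * N) * H ^ d := by
    calc _ = Real.log N * (M * H ^ d) := by ring
      _ ≤ _ := hN.le.trans h1
  exact le_of_mul_le_mul_right h2 (by positivity)

theorem eventually_mul_sqrt_log_le {h : ℕ → ℝ} {d : ℕ} (hh : ∀ N, 0 < h N) {H : ℝ}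
    (hH : ∀ N, h N ≤ H)
    (hrate : Tendsto (fun N : ℕ => Real.log N / (h N ^ (2 * d) * N)) atTop (𝓝 0)) {D ε : ℝ}
    (hD : 0 ≤ D) (hε : 0 < ε) : ∀ᶠ N : ℕ in atTop, D * √(Real.log N / (h N ^ d * N)) ≤ ε := by
  filter_upwards [eventually_mul_log_le_pow_mul hh hH hrate
    (by positivity : 0 < (D / ε) ^ 2 + 1), eventually_ge_atTop 1] with N e1 hN
  have hN0 : (0 : ℝ) < N := by exact_mod_cast hN
  have hhd : 0 < h N ^ d := pow_pos (hh N) d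
  have hlog : 0 ≤ Real.log N := Real.log_natCast_nonneg N
  have e2 : D ^ 2 * (Real.log N / (h N ^ d * N)) ≤ ε ^ 2 := by
    rw [← mul_div_assoc, div_le_iff₀ (by positivity)]
    rw [add_mul, one_mul] at e1
    calc D ^ 2 * Real.log N = ε ^ 2 * ((D / ε) ^ 2 * Real.log N) := by field_simp
      _ ≤ _ := mul_le_mul_of_nonneg_left (by linarith) (sq_nonneg ε)
  calc D * √(Real.log N / (h N ^ d * N)) = √(D ^ 2 * (Real.log N / (h N ^ d * N))) := by
        rw [Real.sqrt_mul (sq_nonneg D), Real.sqrt_sq hD]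
    _ ≤ √(ε ^ 2) := Real.sqrt_le_sqrt e2
    _ = ε := Real.sqrt_sq hε.le

/-- A bound on events `G` of probability tending to one is a bound in probability. -/
theorem IsBigOInProb.of_typical {Ω : ℕ → Type*} [∀ N, MeasurableSpace (Ω N)]
    {P : ∀ N, Measure (Ω N)} [∀ N, IsProbabilityMeasure (P N)] {G : ∀ N, Ω N → Prop} {b : ℕ → ℝ}
    (hb : Tendsto b atTop (𝓝 0)) (hG : ∀ᶠ N in atTop, (P N).real {ω | ¬ G N ω} ≤ b N)
    {Z : ∀ N, Ω N → ℝ} {r : ℕ → ℝ} {M : ℝ}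
    (hZ : ∀ᶠ N in atTop, ∀ ω, G N ω → |Z N ω| ≤ M * r N) : IsBigOInProb P Z r := by
  intro ε hε
  refine ⟨M, ?_⟩
  filter_upwards [hG, hZ, hb.eventually_le_const hε] with N h1 h2 h3
  refine (measureReal_mono fun ω hω => ?_).trans (h1.trans h3)
  exact fun hGω => absurd (h2 ω hGω) (not_le.2 hω)

theorem abs_iSup_abs_le {N : ℕ} {f : Fin N → ℝ} {M : ℝ} (hM : 0 ≤ M) (h : ∀ i, |f i| ≤ M) :
    |⨆ i, (|f i|)| ≤ M := by
  rw [abs_of_nonneg (Real.iSup_nonneg fun _ => abs_nonneg _)]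
  exact Real.iSup_le h hM

end LatentPanel

set_option maxHeartbeats 1000000 in
open LatentPanel in
theorem theorem1 {d : ℕ} {L : Type*} [MeasurableSpace L]
    (A : Set (Vec d)) (ν : Measure (Vec d)) [IsProbabilityMeasure ν]
    (π : Measure L) [IsProbabilityMeasure π]
    (mu0 : Vec d → L → ℝ) (hmu0 : Measurable (Function.uncurry mu0))
    (p : ℕ → ℕ → Vec d → ℝ) (hp : ∀ N s, Measurable (p N s))
    (K : ℝ → ℝ) (T0 T t : ℕ → ℕ) (h : ℕ → ℝ)
    {Ω : ℕ → Type*} [∀ N, MeasurableSpace (Ω N)] [∀ N, StandardBorelSpace (Ω N)]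
    (P : ∀ N, Measure (Ω N)) [∀ N, IsProbabilityMeasure (P N)]
    (X : ∀ N, Panel (Ω N) d L N)
    -- the pre-treatment periods are `1, …, T0 N`, and `t N` is a post-treatment period
    (hT0 : ∀ N, 0 < T0 N) (ht : ∀ N, T0 N < t N ∧ t N ≤ T N)
    (hbin : ∀ N, (X N).BinaryTreatment (P N) (T0 N) (T N))
    (hanticipation : ∀ N, (X N).NoAnticipation (P N) (T N))
    (hunconfounded : ∀ N, (X N).LatentUnconfounded (P N) (T N))
    (hindependent : ∀ N, (X N).LatentIndependent (P N) (T N))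
    (hoverlap : ∃ c : ℝ, 0 < c ∧ ∀ N, (X N).Overlap (P N) (T0 N) (T N) (p N) c)
    (herrors : ∃ δ : ℝ≥0, ∀ N,
      (X N).ErrorConditions (P N) (T0 N) (T N) (t N) mu0 (p N) δ)
    (hsampling : ∀ N, (X N).FactorSampling (P N) (T N) ν π)
    (hlaw : FactorLaw A ν) (hsmooth : Smoothness A mu0 p T)
    (hK : IsKernel K) (hdist : DistanceConditions A mu0 ν π)
    -- the bandwidth is positive and bounded, in particular any positive sequence `h N → 0`
    (hh : ∀ N, 0 < h N) (hhb : ∃ H : ℝ, ∀ N, h N ≤ H)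
    (hrate₁ : Tendsto (fun N : ℕ => 1 / h N * √(Real.log N / T0 N)) atTop (𝓝 0))
    (hrate₂ : Tendsto (fun N : ℕ => Real.log N / (h N ^ (2 * d) * N)) atTop (𝓝 0)) :
    IsBigOInProb P
      (fun N ω => ⨆ i : Fin N,
        |muHat K (h N) (T0 N) (t N) (fun j s => (X N).Y j s ω) (fun j s => (X N).w j s ω) i
          - mu0 ((X N).α i ω) ((X N).lam (t N) ω)|)
      (fun N => h N + √(Real.log N / (h N ^ d * N))) ∧
    IsBigOInProb P
      (fun N ω => ⨆ i : Fin N,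
        |pHat K (h N) (T0 N) (t N) (fun j s => (X N).Y j s ω) (fun j s => (X N).w j s ω) i
          - p N (t N) ((X N).α i ω)|)
      (fun N => h N + √(Real.log N / (h N ^ d * N))) := by
  obtain ⟨κ, hκ, hov⟩ := hoverlap
  obtain ⟨δ, herr⟩ := herrors
  obtain ⟨hAc, hA, cν, Cν, η₀, hcν, -, hη₀, hball⟩ := hlaw
  obtain ⟨⟨B', hB', -⟩, ⟨L0', hL0'⟩, ⟨Lp', hLp'⟩⟩ := hsmooth
  obtain ⟨R, hR⟩ := hK.compact_support
  obtain ⟨BK, hBK⟩ := hK.bounded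
  obtain ⟨LK, hLK⟩ := hK.lipschitz
  obtain ⟨c₁, c₂, hc₁, hc₂, hdist⟩ := hdist
  obtain ⟨H, hH⟩ := hhb
  have hK0 := hK.pos_zero
  have hH0 : 0 < H := (hh 0).trans_le (hH 0)
  have hBK0 : 0 ≤ BK := hK0.le.trans (hBK 0 le_rfl)
  have hmu : ∀ a, Measurable (mu0 a) := fun a => hmu0.comp measurable_prodMk_left
  -- Replace the constants of the assumptions by positive ones.
  obtain ⟨B, hB, hbd⟩ : ∃ B : ℝ, 0 < B ∧ ∀ a ∈ A, ∀ l, |mu0 a l| ≤ B :=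
    ⟨|B'| + 1, by positivity, fun a ha l => by
      linarith [hB' a ha l, le_abs_self B']⟩
  obtain ⟨L0, hL0, hlip⟩ : ∃ L0 : ℝ, 0 < L0 ∧
      ∀ a ∈ A, ∀ b ∈ A, ∀ l, |mu0 a l - mu0 b l| ≤ L0 * ‖a - b‖ :=
    ⟨|L0'| + 1, by positivity, fun a ha b hb l => (hL0' a ha b hb l).trans
      (mul_le_mul_of_nonneg_right (by linarith [le_abs_self L0']) (norm_nonneg _))⟩
  obtain ⟨Lp, hLp, hplip⟩ : ∃ Lp : ℝ, 0 < Lp ∧ ∀ N, ∀ s ∈ Finset.Icc 1 (T N),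
      ∀ a ∈ A, ∀ b ∈ A, |p N s a - p N s b| ≤ Lp * ‖a - b‖ :=
    ⟨|Lp'| + 1, by positivity, fun N s hs a ha b hb => (hLp' N s hs a ha b hb).trans
      (mul_le_mul_of_nonneg_right (by linarith [le_abs_self Lp']) (norm_nonneg _))⟩
  obtain ⟨z₀, hz₀, hlow⟩ : ∃ z₀ : ℝ, 0 < z₀ ∧ ∀ z, 0 ≤ z → z ≤ z₀ → K 0 / 2 ≤ K z := by
    refine ⟨K 0 / (2 * (|LK| + 1)), by positivity, fun z hz hzz => ?_⟩
    have h1 := (abs_le.1 (hLK z 0 hz le_rfl)).1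
    rw [sub_zero, abs_of_nonneg hz] at h1
    rw [le_div_iff₀ (by positivity)] at hzz
    nlinarith [le_abs_self LK]
  -- A fluctuation of size `x₁ h` in each of the three sums keeps the pseudo-distance within
  -- `z₀ h / 2` of its limit, and neighbours at distance `r₁ h` contribute at most `z₀ h / 2`.
  obtain ⟨x₁, hx₁, hx₁z⟩ : ∃ x₁ : ℝ, 0 < x₁ ∧ 2 * (3 * x₁) = z₀ / 2 :=
    ⟨z₀ / 12, by positivity, by ring⟩
  obtain ⟨r₁, hr₁, hr₁z, hr₁η⟩ : ∃ r₁ : ℝ, 0 < r₁ ∧ B * L0 * r₁ ≤ z₀ / 2 ∧ r₁ * H ≤ η₀ := by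
    refine ⟨min (z₀ / 2 / (B * L0)) (η₀ / H), by positivity, ?_, ?_⟩
    · rw [mul_comm, ← le_div_iff₀ (by positivity)]
      exact min_le_left _ _
    · rw [← le_div_iff₀ hH0]
      exact min_le_right _ _
  obtain ⟨ρ, hρ, hρc, hρη⟩ : ∃ ρ : ℝ, 0 < ρ ∧ L0 * (2 * ρ) ≤ c₂ / 4 ∧ ρ ≤ η₀ := by
    refine ⟨min (c₂ / 8 / L0) η₀, by positivity, ?_, min_le_right _ _⟩
    have : min (c₂ / 8 / L0) η₀ * L0 ≤ c₂ / 8 := by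
      rw [← le_div_iff₀ hL0]
      exact min_le_left _ _
    linarith
  obtain ⟨net, hnetS, hnet⟩ : ∃ net : Finset (Vec d), (∀ e ∈ net, e ∈ ν.support) ∧
      ν.support ⊆ ⋃ e ∈ net, Metric.closedBall e ρ := by
    have hcomp : IsCompact ν.support := hAc.of_isClosed_subset Measure.isClosed_support hA
    obtain ⟨s, hs, hfin, hcov⟩ := hcomp.finite_cover_balls hρ
    refine ⟨hfin.toFinset, fun e he => hs (hfin.mem_toFinset.1 he), fun e he => ?_⟩
    obtain ⟨e₀, he₀, hmem⟩ := Set.mem_iUnion₂.1 (hcov he)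
    exact Set.mem_iUnion₂.2 ⟨e₀, hfin.mem_toFinset.2 he₀, Metric.ball_subset_closedBall hmem⟩
  set c : ℝ := 2 * δ + 1 with hc
  have hc0 : 0 < c := by positivity
  set V : ℝ := 2 * c * (2 * B ^ 2 + 16 * c) + 2 * B ^ 4 with hV
  have hV0 : 0 < V := by positivity
  set qρ : ℝ := cν * ρ ^ d with hqρ
  have hqρ0 : 0 < qρ := by positivity
  -- `s * N * h ^ d` bounds the total kernel weight of an individual from below.
  set s : ℝ := K 0 / 2 * (cν * r₁ ^ d) / 8 with hs
  have hs0 : 0 < s := by positivity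
  let x : ℕ → ℝ := fun N => x₁ * h N
  let y : ℕ → ℝ := fun N => √(4 * c * Real.log N)
  let q : ℕ → ℝ := fun N => cν * (r₁ * h N) ^ d
  let n₀ : ℕ → ℝ := fun N => ((N : ℝ) - 1) * q N / 4
  let S₀ : ℕ → ℝ := fun N => K 0 / 2 * n₀ N
  let rate : ℕ → ℝ := fun N => √(Real.log N / (h N ^ d * N))
  let G : ∀ N, Ω N → Prop := fun N ω =>
    TypicalSample (X N) mu0 (p N) K ν π (h N) (T0 N) (t N) κ net ρ (3 * x N) (y N) (r₁ * h N)
      (n₀ N) ω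
  have hS₀s : ∀ N : ℕ, 2 ≤ N → s * (h N ^ d * N) ≤ S₀ N := fun N hN => by
    have hN2 : (2 : ℝ) ≤ N := by exact_mod_cast hN
    have hhd : 0 < h N ^ d := pow_pos (hh N) d
    have hq0 : 0 < K 0 / 2 * (cν * r₁ ^ d) * h N ^ d := by positivity
    simp only [S₀, n₀, q, hs, mul_pow]
    nlinarith
  have hlogN : ∀ N : ℕ, 0 ≤ Real.log N := fun N => Real.log_natCast_nonneg N
  set D : ℝ := √(4 * c * BK / s) with hD
  have hnoise : ∀ N : ℕ, 2 ≤ N → y N * √BK / √(S₀ N) ≤ D * rate N := fun N hN => by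
    have hN0 : (0 : ℝ) < N := by exact_mod_cast (by omega : 0 < N)
    have hhd : 0 < h N ^ d := pow_pos (hh N) d
    have hlog := hlogN N
    calc y N * √BK / √(S₀ N) ≤ y N * √BK / √(s * (h N ^ d * N)) := by
          gcongr
          exact hS₀s N hN
      _ = D * rate N := by
          simp only [y, rate, hD]
          rw [← Real.sqrt_mul (by positivity), ← Real.sqrt_div (by positivity),
            ← Real.sqrt_mul (by positivity)]
          congr 1
          field_simp
  have ev₁ := fun {M : ℝ} (hM : 0 < M) => eventually_mul_log_le_sq_mul hh hT0 hrate₁ hM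
  have ev₂ := fun {M : ℝ} (hM : 0 < M) => eventually_mul_log_le_pow_mul hh hH hrate₂ hM
  have hprob : ∀ᶠ N : ℕ in atTop, (P N).real {ω | ¬ G N ω} ≤
      12 / N + net.card * Real.exp (-(N * qρ / 4)) := by
    filter_upwards [eventually_ge_atTop 2, ev₁ (M := 3 * H ^ 2) (by positivity),
      ev₁ (M := 3 * V / x₁ ^ 2) (by positivity), ev₂ (M := 16 / (cν * r₁ ^ d)) (by positivity),
      tendsto_natCast_atTop_atTop.eventually_ge_atTop (8 / qρ)] with N hN2 e1 e2 e3 e4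
    have hN2' : (2 : ℝ) ≤ N := by exact_mod_cast hN2
    have hhN := hh N
    have hHN : h N ^ 2 ≤ H ^ 2 := pow_le_pow_left₀ hhN.le (hH N) 2
    refine measureReal_not_typicalSample_le (by omega) (ht N) hmu0 (hp N) (hbin N)
      (hanticipation N) (hunconfounded N) (hov N) (herr N) (hsampling N) hK hhN hA hB hbd
      (by positivity) (Real.sqrt_nonneg _) (fun a ha => ?_) (fun a ha => ?_) ?_ ?_ ?_ ?_ ?_
    · refine (hball a ha (r₁ * h N) (by positivity) ?_).1
      exact (mul_le_mul_of_nonneg_left (hH N) hr₁.le).trans hr₁η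
    · exact (hball a (hnetS a ha) ρ hρ hρη).1
    · have : H ^ 2 * (3 * Real.log N) ≤ H ^ 2 * T0 N := by
        calc H ^ 2 * (3 * Real.log N) = 3 * H ^ 2 * Real.log N := by ring
          _ ≤ h N ^ 2 * T0 N := e1
          _ ≤ _ := by gcongr
      exact le_of_mul_le_mul_left this (by positivity)
    · show 3 * Real.log N ≤ (x₁ * h N) ^ 2 * T0 N / V
      rw [le_div_iff₀ hV0, mul_pow, mul_assoc (x₁ ^ 2)]
      rw [div_mul_eq_mul_div, div_le_iff₀ (by positivity)] at e2
      linarith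
    · show 2 * Real.log N ≤ √(4 * c * Real.log N) ^ 2 / (2 * c)
      rw [Real.sq_sqrt (mul_nonneg (by positivity) (hlogN N))]
      apply le_of_eq
      field_simp
      ring
    · show 2 * Real.log N ≤ ((N : ℝ) - 1) * (cν * (r₁ * h N) ^ d) / 4
      have hQ : 0 < cν * r₁ ^ d := by positivity
      have hhd : 0 < h N ^ d := pow_pos hhN d
      rw [div_mul_eq_mul_div, div_le_iff₀ hQ] at e3
      rw [mul_pow]
      nlinarith [mul_pos hQ hhd]
    · rw [div_le_iff₀ hqρ0] at e4
      linarith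
  have hb0 : Tendsto (fun N : ℕ => 12 / (N : ℝ) + net.card * Real.exp (-(N * qρ / 4))) atTop
      (𝓝 0) := by
    have t1 : Tendsto (fun N : ℕ => 12 / (N : ℝ)) atTop (𝓝 0) :=
      tendsto_const_div_atTop_nhds_zero_nat 12
    have t2 : Tendsto (fun N : ℕ => Real.exp (-((N : ℝ) * qρ / 4))) atTop (𝓝 0) := by
      refine Real.tendsto_exp_neg_atTop_nhds_zero.comp ?_
      exact (tendsto_natCast_atTop_atTop.atTop_mul_const hqρ0).atTop_div_const (by norm_num)
    simpa using t1.add (t2.const_mul (net.card : ℝ))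
  -- Individuals that receive weight are within `C * h` of each other.
  set C : ℝ := (|R| + 6 * x₁) / (c₂ / 4 * √c₁) with hC
  have hC0 : 0 < C := by positivity
  have hclose : ∀ N ω, G N ω → ∀ i j,
      K (pseudoDist (T0 N) (fun k s => (X N).Y0 k s ω) i j / h N) ≠ 0 →
        ‖(X N).α i ω - (X N).α j ω‖ ≤ C * h N := fun N ω hG i j hne => by
    have hhN := hh N
    have h1 := TypicalSample.norm_sub_le_pseudoDist hG (hT0 N) hmu hA hL0.le hbd hlip hc₁ hc₂
      hdist hnet hρc i j
    have h2 : pseudoDist (T0 N) (fun k s => (X N).Y0 k s ω) i j ≤ |R| * h N := by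
      rw [← div_le_iff₀ hhN]
      exact (not_lt.1 fun hlt => hne (hR _ hlt)).trans (le_abs_self R)
    rw [hC, div_mul_eq_mul_div, le_div_iff₀ (by positivity)]
    simp only [x] at h1
    linarith
  have hweight : ∀ N ω, G N ω → ∀ i,
      S₀ N ≤ ∑ j, K (pseudoDist (T0 N) (fun k s => (X N).Y0 k s ω) i j / h N) :=
    fun N ω hG i => by
    have hhN := hh N
    have hx0 : 0 ≤ 3 * x N := by positivity
    refine TypicalSample.le_sum_kernel hG hK.nonneg (by positivity) hlow hhN (B := B * L0)
      (by positivity) (fun i j => ?_) ?_ i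
    · rw [mul_assoc]
      exact TypicalSample.pseudoDist_le hG (hT0 N) hx0 hmu hA hB.le hL0.le hbd hlip i j
    · have e1 := mul_le_mul_of_nonneg_right hr₁z hhN.le
      have e2 : 2 * (3 * x N) = z₀ / 2 * h N := by rw [← hx₁z]; simp only [x]; ring
      rw [e2]
      linarith
  have hS₀pos : ∀ N : ℕ, 2 ≤ N → 0 < S₀ N := fun N hN => by
    have hN0 : (0 : ℝ) < N := by exact_mod_cast (by omega : 0 < N)
    have hhd : 0 < h N ^ d := pow_pos (hh N) d
    exact lt_of_lt_of_le (by positivity) (hS₀s N hN)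
  have hrate0 : ∀ N, 0 ≤ rate N := fun N => Real.sqrt_nonneg _
  have hD0 : 0 ≤ D := Real.sqrt_nonneg _
  constructor
  · refine IsBigOInProb.of_typical (M := L0 * C + 2 / κ * D) hb0 hprob ?_
    have hsmall := eventually_mul_sqrt_log_le hh hH hrate₂ hD0 (half_pos hκ)
    filter_upwards [eventually_ge_atTop 2, hsmall] with N hN hsm ω hG
    have hhN := hh N
    have hr0 := hrate0 N
    refine abs_iSup_abs_le (by positivity) fun i => ?_
    refine (TypicalSample.abs_muHat_sub_le hG hhN (Real.sqrt_nonneg _) hK.nonneg hBK0 hBK hκ hA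
      hL0.le hlip (hS₀pos N hN) (hweight N ω hG) (hclose N ω hG) ((hnoise N hN).trans hsm)
      i).trans ?_
    have e1 : 2 / κ * (y N * √BK / √(S₀ N)) ≤ 2 / κ * (D * rate N) := by
      gcongr
      exact hnoise N hN
    have e2 : 0 ≤ L0 * C * rate N := by positivity
    have e3 : 0 ≤ 2 / κ * D * h N := by positivity
    show _ ≤ (L0 * C + 2 / κ * D) * (h N + rate N)
    linarith
  · refine IsBigOInProb.of_typical (M := Lp * C + D) hb0 hprob ?_
    filter_upwards [eventually_ge_atTop 2] with N hN ω hG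
    have hhN := hh N
    have hr0 := hrate0 N
    refine abs_iSup_abs_le (by positivity) fun i => ?_
    refine (TypicalSample.abs_pHat_sub_le hG hhN (Real.sqrt_nonneg _) hK.nonneg hBK0 hBK hA
      hLp.le (hplip N (t N) (Finset.mem_Icc.2 ⟨by have := ht N; omega, (ht N).2⟩)) (hS₀pos N hN)
      (hweight N ω hG) (hclose N ω hG) i).trans ?_
    have e1 := hnoise N hN
    have e2 : 0 ≤ Lp * C * rate N := by positivity
    have e3 : 0 ≤ D * h N := by positivity
    show _ ≤ (Lp * C + D) * (h N + rate N)
    linarith
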